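/- Let $\Gamma$ be a countably infinite amenable group with identity element $\mathbf 1$, let $S\subseteq\Gamma$ be a generating set, and let $\alpha\colon\Gamma\curvearrowright(X,\mu)$ be an ergodic measure-preserving Borel action of $\Gamma$ on a standard probability space that is free (for $\mu$-almost every $x$, $\gamma\cdot x=x$ only for $\gamma=\mathbf 1$). Let $(\Phi_n)_{n=0}^\infty$ be a Følner sequence in $\Gamma$, i.e. a sequence of nonempty finite subsets with $|\gamma\Phi_n\triangle\Phi_n|/|\Phi_n|\to0$ for every $\gamma\in\Gamma$, such that - each $\Phi_n$ induces a connected subgraph of the Cayley graph of $\Gamma$ in which $\delta$ is adjacent to $\gamma\delta\neq\delta$ for $\gamma\in S$, $\delta\in\Gamma$; - $\mathbf 1\in\Phi_0\subsetneq\Phi_1\subsetneq\cdots$ and $\bigcup_n\Phi_n=\Gamma$; - $\lim_{n\to\infty}|\Phi_n|/\log_2 n=\infty$. Fix a linear ordering $<$ of $\Gamma$ and an identification of $\Gamma$ with $\mathbb N$, and let $\mathbb O$ be an oracle relative to which the group operation, the ordering $<$, the set $\{(\gamma,n):\gamma\in\Phi_n\}$ and the sequence $(|\Phi_n|)_{n=0}^\infty$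 are computable. For a partial function $D\colon 2^*\rightharpoonup2^*$ on finite binary words put $K_D(x)=\inf\{|w|:D(w)=x\}$. Let $K_{\mathbb O}=K_D$ be the Kolmogorov complexity relative to $\mathbb O$, where $D$ is any fixed optimal partial function computable relative to $\mathbb O$: for every partial function $D'\colon2^*\rightharpoonup2^*$ computable relative to $\mathbb O$ there is $c\in\mathbb N$ with $K_D(x)\le K_{D'}(x)+c$ for all $x$. For a finite set $\Phi\subset\Gamma$, identify $w\colon\Phi\to2^s$ with the binary word of length $s|\Phi|$ obtained by concatenating the values $w(\gamma)\in 2^s=\{0,1\}^s$ in the increasing order of $\gamma\in\Phi$. For $f\colon X\to I$ and finite $\Phi\subset\Gamma$ let $f^{\Phi}\colon X\to I^\Phi$, $f^\Phi(x)(\gamma)=f(\gamma\cdot x)$. For a Borel $f\colon X\to I$ with $I$ finite, let $h_\mu(f)=-\sum_{i\in I}\mu(f^{-1}(i))\log_2\mu(f^{-1}(i))$ be its Shannon entropy (with $0\log_20=0$), and let $H_\mu(\alpha,f)=\lim_{n\to\infty}h_\mu(f^{\Psi_n})/|\Psi_n|$ be its Kolmogorov–Sinai entropy, where $(\Psi_n)_{n=0}^\infty$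 is any Følner sequence in $\Gamma$ (the limit exists and does not depend on the Følner sequence). Then for every $s\in\mathbb N$ and every Borel map $f\colon X\to 2^s$, $$\limsup_{m\to\infty}\int_X\frac{K_{\mathbb O}(f^{\Phi_m}(x))}{|\Phi_m|}\,d\mu(x)\;\le\;H_\mu(\alpha,f).$$ -/

import Mathlib

open MeasureTheory Filter Topology
open scoped ENNReal Pointwise symmDiff

/-! ### Følner sequences -/

/-- A (left) Følner sequence: nonempty finite sets with `|γ Φₙ ∆ Φₙ| / |Φₙ| → 0` for all `γ`. -/
structure IsFolnerSeq {Γ : Type*} [Group Γ] [DecidableEq Γ] (Φ : ℕ → Finset Γ) : Prop where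
  nonempty : ∀ n, (Φ n).Nonempty
  tendsto : ∀ γ : Γ,
    Tendsto (fun n => (((γ • Φ n) ∆ Φ n).card : ℝ) / ((Φ n).card : ℝ)) atTop (𝓝 0)

/-- The Cayley graph in which `δ` is joined to `γ * δ` for `γ ∈ S` (left multiplication by
generators; Mathlib's `SimpleGraph.mulCayley` multiplies on the right). -/
def leftCayley {Γ : Type*} [Group Γ] (S : Set Γ) : SimpleGraph Γ :=
  SimpleGraph.fromRel fun a b => ∃ γ ∈ S, γ * a = b

/-- A good Følner sequence with respect to the generating set `S`: each `Φₙ` induces a connected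
subgraph of the Cayley graph, `1 ∈ Φ₀ ⊊ Φ₁ ⊊ ⋯`, the union is `Γ`, and `|Φₙ| / log₂ n → ∞`. -/
structure IsGoodFolnerSeq {Γ : Type*} [Group Γ] [DecidableEq Γ] (S : Set Γ)
    (Φ : ℕ → Finset Γ) : Prop extends IsFolnerSeq Φ where
  connected : ∀ n, ((leftCayley S).induce (Φ n : Set Γ)).Connected
  one_mem : 1 ∈ Φ 0
  strictMono : StrictMono Φ
  exhaustive : ∀ γ : Γ, ∃ n, γ ∈ Φ n
  growth : Tendsto (fun n : ℕ => ((Φ n).card : ℝ) / Real.logb 2 (n : ℝ)) atTop atTop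

/-! ### Kolmogorov–Sinai entropy -/

/-- The coloring `f^Φ`, given by `f^Φ(x)(γ) = f (γ • x)` for `γ ∈ Φ`. -/
def coloringPow {Γ X I : Type*} [SMul Γ X] (f : X → I) (Φ : Finset Γ) (x : X) : Φ → I :=
  fun γ => f ((γ : Γ) • x)

/-- Shannon entropy (base 2) of a finite coloring; here `Real.logb 2 0 = 0`. -/
noncomputable def shannonEntropy {X I : Type*} [MeasurableSpace X] [Fintype I]
    (μ : Measure X) (f : X → I) : ℝ :=
  -∑ i : I, μ.real (f ⁻¹' {i}) * Real.logb 2 (μ.real (f ⁻¹' {i}))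

/-- `H` is the Kolmogorov–Sinai entropy of the finite coloring `f` with respect to the action of
`Γ` on `(X, μ)`: the quotients `h_μ(f^{Ψₙ}) / |Ψₙ|` converge to `H` along every Følner sequence
`Ψ` (so `H` is unique as soon as `Γ` has a Følner sequence). -/
def IsKSEntropy (Γ : Type*) {X I : Type*} [Group Γ] [DecidableEq Γ] [MulAction Γ X]
    [MeasurableSpace X] [Fintype I] (μ : Measure X) (f : X → I) (H : ℝ) : Prop :=
  ∀ Ψ : ℕ → Finset Γ, IsFolnerSeq Ψ →
    Tendsto (fun n => shannonEntropy μ (coloringPow f (Ψ n)) / ((Ψ n).card : ℝ)) atTop (𝓝 H)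

/-! ### Kolmogorov complexity -/

/-- `K_D(x) = inf {|w| : D(w) = x}`, with value `⊤` if `x` is not in the range of `D`. -/
noncomputable def complexityOf (D : List Bool →. List Bool) (x : List Bool) : ℕ∞ :=
  ⨅ w ∈ {w : List Bool | x ∈ D w}, (w.length : ℕ∞)

/-- `D₁` minorizes `D₂`: `K_{D₁} ≤ K_{D₂} + c` for some constant `c`. -/
def Minorizes (D₁ D₂ : List Bool →. List Bool) : Prop :=
  ∃ c : ℕ, ∀ x, complexityOf D₁ x ≤ complexityOf D₂ x + c

/-- `D` is optimal among the partial maps on binary words that are computable relative to the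
oracle `O`. The Kolmogorov complexity relative to `O` is `complexityOf D` for such a `D`. -/
structure IsOptimal (O : ℕ → ℕ) (D : List Bool →. List Bool) : Prop where
  recursiveIn : RecursiveIn {(O : ℕ →. ℕ)} D
  minorizes : ∀ D' : List Bool →. List Bool, RecursiveIn {(O : ℕ →. ℕ)} D' → Minorizes D D'

/-- The predicate `p` is decidable relative to the oracle `O`. -/
def IsDecidableRelTo {α : Type*} [Primcodable α] (O : ℕ → ℕ) (p : α → Prop) : Prop :=
  ∃ b : α → Bool, ComputableIn {(O : ℕ →. ℕ)} b ∧ ∀ a, b a = true ↔ p a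

/-- Relative to the oracle `O`, and through the identification `e` of `Γ` with `ℕ`, the group
operation, the linear order, the relation `γ ∈ Φₙ` and the sequence `|Φₙ|` are computable
(computability of inverses follows from that of multiplication). -/
structure IsSuitableOracle {Γ : Type*} [Group Γ] [LinearOrder Γ] (O : ℕ → ℕ) (e : Γ ≃ ℕ)
    (Φ : ℕ → Finset Γ) : Prop where
  mul : ComputableIn {(O : ℕ →. ℕ)} fun p : ℕ × ℕ => e (e.symm p.1 * e.symm p.2)
  lt : IsDecidableRelTo O fun p : ℕ × ℕ => e.symm p.1 < e.symm p.2
  mem : IsDecidableRelTo O fun p : ℕ × ℕ => e.symm p.1 ∈ Φ p.2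
  card : ComputableIn {(O : ℕ →. ℕ)} fun n : ℕ => (Φ n).card

/-- The binary word of length `s * |Φ|` identified with `w : Φ → 2^s`: the blocks `w γ` are
concatenated in increasing order of `γ ∈ Φ`. -/
def wordOf {Γ : Type*} [LinearOrder Γ] {s : ℕ} {Φ : Finset Γ} (w : Φ → (Fin s → Bool)) :
    List Bool :=
  (List.ofFn fun i : Fin Φ.card => List.ofFn (w (Φ.orderIsoOfFin rfl i))).flatten

/-! The argument is arithmetic coding with a finite context, followed by an averaging over the
position of the context window. Fix a finite nonempty `F` and some `g ∈ F`. Write the coloring of `Φ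
m` letter by letter in increasing order, predicting the letter at `φ` from the colors at those
points of `F * g⁻¹ * φ` that lie in `Φ m` below `φ`. Conditional probabilities, scaled by `M` and
rounded up, are a finite table of integers, so a decoder can use them although `μ` need not be
computable. The weights of the letters in any context sum to at most `N = M + |V|`, where `V` is the
alphabet; hence all colorings of `Φ m` have total weight at most `N ^ |Φ m|`, and one of weight at
least `N ^ |Φ m| / 2 ^ κ` is named by `κ` bits (`complexityOf_le_of_weight`). For almost every `x`,
`κ` may be `condInfo` plus `|Φ m| * log₂ (N / M)`, rounded up (`pow_card_le_mul_colorWeight`);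
announcing `m` costs `O(log m)` bits, negligible by the growth of `|Φ m|`. Summed over `g ∈ F`, the
conditional informations regroup by the chain rule into the informations of the windows `Φ m ∩ F *
δ`, `δ ∈ F⁻¹ * Φ m` (`sum_condInfo_translates`). By invariance some `g` has mean conditional
information at most `|F⁻¹ * Φ m| / |F|` times the entropy of `f^F`, and `|F⁻¹ * Φ m| / |Φ m|` is
asymptotically at most 1. Letting `M → ∞` and optimizing `F` gives the bound `infEntropy`. The same
averaging shows that this infimum is the Kolmogorov–Sinai entropy, since the entropy of `f^Φ` never
exceeds the mean of `condInfo` (`shannonEntropy_le_integral_condInfo`). -/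

/-! ### Computability relative to an oracle -/

namespace ComputableIn

variable {α β γ σ : Type*} [Primcodable α] [Primcodable β] [Primcodable γ] [Primcodable σ]
  {O : Set (ℕ →. ℕ)}

protected theorem comp {f : β → σ} {g : α → β} (hf : ComputableIn O f)
    (hg : ComputableIn O g) : ComputableIn O fun a => f (g a) :=
  (Nat.RecursiveIn.comp hf hg).of_eq fun n => by
    rcases e : Encodable.decode (α := α) n with - | a <;> simp [Encodable.encodek]

protected theorem pair {f : α → β} {g : α → γ} (hf : ComputableIn O f)
    (hg : ComputableIn O g) : ComputableIn O fun a => (f a, g a) :=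
  (Nat.RecursiveIn.pair hf hg).of_eq fun n => by
    rcases e : Encodable.decode (α := α) n with - | a <;> simp [Seq.seq]

theorem nat_rec {f : α → ℕ} {g : α → σ} {h : α × ℕ × σ → σ} (hf : ComputableIn O f)
    (hg : ComputableIn O g) (hh : ComputableIn O h) :
    ComputableIn O fun a =>
      Nat.rec (motive := fun _ => σ) (g a) (fun y IH => h (a, y, IH)) (f a) := by
  have key := (Nat.RecursiveIn.prec hg hh).comp
    ((RecursiveIn.iff_nat.1 RecursiveIn.some).pair hf)
  refine Nat.RecursiveIn.of_eq key fun n => ?_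
  rcases e : Encodable.decode (α := α) n with - | a
  · simp [Seq.seq]
  · simp only [Seq.seq]
    simp
    induction f a <;> simp_all

theorem exists_search {p : α × ℕ → Bool} (hp : ComputableIn O p)
    (h : ∀ a, ∃ n, p (a, n) = true) :
    ∃ k : α → ℕ, ComputableIn O k ∧ ∀ a, p (a, k a) = true := by
  refine ⟨fun a => Nat.find (h a), ?_, fun a => Nat.find_spec (h a)⟩
  -- `Nat.RecursiveIn.rfind` searches for a zero, so success is coded as `0`.
  have hq : ComputableIn O fun x => cond (p x) 0 1 :=
    ((Primrec.dom_bool fun b => cond b 0 1).computableIn).comp hp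
  refine Nat.RecursiveIn.of_eq (Nat.RecursiveIn.rfind hq) fun n => ?_
  rcases e : Encodable.decode (α := α) n with - | a
  · simp only [Part.coe_none, Part.bind_none, Encodable.decode_prod_val]
    simpa [e] using Nat.rfind_zero_none (fun _ => Part.none) rfl
  · have : Nat.rfind (fun n => Part.some (p (a, n))) = Part.some (Nat.find (h a)) := by
      refine Part.eq_some_iff.2 (Nat.mem_rfind.2 ⟨?_, fun {m} hm => ?_⟩)
      · simpa using Nat.find_spec (h a)
      · have := Nat.find_min (h a) hm
        simpa using this
    simp [e, ← this]
    congr 1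
    funext n
    cases p (a, n) <;> simp

theorem ite {p : α → Bool} {f g : α → σ} (hp : ComputableIn O p) (hf : ComputableIn O f)
    (hg : ComputableIn O g) : ComputableIn O fun a => if p a = true then f a else g a := by
  have : Primrec fun x : Bool × σ × σ => if x.1 = true then x.2.1 else x.2.2 :=
    Primrec.ite (Primrec.eq.comp Primrec.fst (Primrec.const true))
      (Primrec.fst.comp Primrec.snd) (Primrec.snd.comp Primrec.snd)
  exact this.computableIn.comp (hp.pair (hf.pair hg))

theorem and {p q : α → Bool} (hp : ComputableIn O p) (hq : ComputableIn O q) :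
    ComputableIn O fun a => p a && q a :=
  (Primrec.and.comp Primrec.fst Primrec.snd).computableIn.comp (hp.pair hq)

theorem beq [DecidableEq σ] {f g : α → σ} (hf : ComputableIn O f) (hg : ComputableIn O g) :
    ComputableIn O fun a => decide (f a = g a) :=
  (Primrec.eq.decide.comp Primrec.fst Primrec.snd).computableIn.comp (hf.pair hg)

theorem sum_range {f : α × ℕ → ℕ} {k : α → ℕ} (hf : ComputableIn O f) (hk : ComputableIn O k) :
    ComputableIn O fun a => ∑ i ∈ Finset.range (k a), f (a, i) := by
  have hh : ComputableIn O fun x : α × ℕ × ℕ => x.2.2 + f (x.1, x.2.1) :=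
    (Primrec.nat_add.comp Primrec.fst Primrec.snd).computableIn.comp
      ((Primrec.snd.comp Primrec.snd).computableIn.pair (hf.comp
        (Primrec.pair Primrec.fst (Primrec.fst.comp Primrec.snd)).computableIn))
  convert nat_rec hk (ComputableIn.const 0) hh using 2 with a
  induction k a with
  | zero => rfl
  | succ n ih => rw [Finset.sum_range_succ, ih]

theorem map_range {f : α × ℕ → σ} {k : α → ℕ} (hf : ComputableIn O f) (hk : ComputableIn O k) :
    ComputableIn O fun a => (List.range (k a)).map fun i => f (a, i) := by
  have hh : ComputableIn O fun x : α × ℕ × List σ => x.2.2 ++ [f (x.1, x.2.1)] :=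
    (Primrec.list_concat.comp Primrec.fst Primrec.snd).computableIn.comp
      ((Primrec.snd.comp Primrec.snd).computableIn.pair (hf.comp
        (Primrec.pair Primrec.fst (Primrec.fst.comp Primrec.snd)).computableIn))
  convert nat_rec hk (ComputableIn.const []) hh using 2 with a
  induction k a with
  | zero => rfl
  | succ n ih => rw [List.range_succ, List.map_append, ih]; rfl

theorem pi_fin {r : ℕ} {f : Fin r → α → σ} (hf : ∀ l, ComputableIn O (f l)) :
    ComputableIn O fun a l => f l a := by
  induction r with
  | zero =>
    exact (funext fun a => funext fun l => l.elim0 :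
      (fun (_ : α) (l : Fin 0) => l.elim0) = fun a l => f l a) ▸ ComputableIn.const _
  | succ r ih =>
    have hc : Primrec fun x : σ × (Fin r → σ) => (Fin.cons x.1 x.2 : Fin (r + 1) → σ) := by
      refine Primrec.fin_curry.2 (Primrec₂.swap (Primrec.fin_curry₁.2 fun i => ?_))
      refine Fin.cases ?_ (fun j => ?_) i
      · simpa using Primrec.fst
      · simpa using Primrec.fin_app.comp Primrec.snd (Primrec.const j)
    convert hc.computableIn.comp ((hf 0).pair (ih fun l => hf l.succ)) using 2 with a
    funext l
    refine Fin.cases ?_ (fun j => ?_) l <;> simp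

end ComputableIn

/-! ### Binary numerals and headers -/

/-- The number with binary digits `w`, most significant digit first. -/
def binVal (w : List Bool) : ℕ :=
  w.foldl (fun a b => 2 * a + b.toNat) 0

theorem exists_binVal_eq (n m : ℕ) (h : m < 2 ^ n) :
    ∃ w : List Bool, w.length = n ∧ binVal w = m := by
  induction n generalizing m with
  | zero => exact ⟨[], rfl, by simp at h; simp [binVal, h]⟩
  | succ n ih =>
    obtain ⟨w, hw, hv⟩ := ih (m / 2) (by rw [pow_succ] at h; omega)
    refine ⟨w ++ [decide (m % 2 = 1)], by simp [hw], ?_⟩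
    have : binVal (w ++ [decide (m % 2 = 1)]) = 2 * binVal w + (decide (m % 2 = 1)).toNat := by
      simp [binVal]
    rw [this, hv]
    rcases Nat.mod_two_eq_zero_or_one m with h' | h' <;> simp [h'] <;> omega

theorem primrec_binVal : Primrec binVal := by
  refine Primrec.list_foldl (h := fun _ (p : ℕ × Bool) => 2 * p.1 + p.2.toNat) Primrec.id
    (Primrec.const 0) ?_
  exact Primrec.nat_add.comp
    (Primrec.nat_mul.comp (Primrec.const 2) (Primrec.fst.comp Primrec.snd))
    ((Primrec.dom_finite Bool.toNat).comp (Primrec.snd.comp Primrec.snd))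

/-- Splits `1^ℓ 0 u v` with `|u| = ℓ` into the number with digits `u` and the word `v`. -/
def parseHeader (w : List Bool) : ℕ × List Bool :=
  (binVal ((w.drop (w.findIdx (!·) + 1)).take (w.findIdx (!·))),
    (w.drop (w.findIdx (!·) + 1)).drop (w.findIdx (!·)))

theorem primrec_parseHeader : Primrec parseHeader := by
  have h1 : Primrec fun w : List Bool => w.findIdx (!·) :=
    Primrec.list_findIdx Primrec.id (Primrec.not.comp Primrec.snd)
  have h2 : Primrec fun w : List Bool => w.drop (w.findIdx (!·) + 1) :=
    Primrec.list_drop.comp (Primrec.succ.comp h1) Primrec.id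
  exact (primrec_binVal.comp (Primrec.list_take.comp h1 h2)).pair (Primrec.list_drop.comp h1 h2)

/-- A self-delimiting prefix: the unary length ends at the first `false`, so `m` costs twice its
binary length plus one separator, and `v` follows at no extra cost. -/
theorem exists_parseHeader_eq (m : ℕ) (v : List Bool) :
    ∃ w : List Bool, w.length = v.length + 2 * Nat.size m + 1 ∧ parseHeader w = (m, v) := by
  obtain ⟨u, hu, hm⟩ := exists_binVal_eq _ m (Nat.lt_size_self m)
  refine ⟨List.replicate (Nat.size m) true ++ (false :: (u ++ v)), by simp [hu]; ring, ?_⟩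
  have h1 : (List.replicate (Nat.size m) true ++ (false :: (u ++ v))).findIdx (!·) =
      Nat.size m := by
    rw [List.findIdx_append]
    have : (List.replicate (Nat.size m) true).findIdx (!·) = Nat.size m := by
      rw [List.findIdx_eq_length_of_false] <;> simp
    simp [this, List.findIdx_cons]
  have h2 : (List.replicate (Nat.size m) true ++ (false :: (u ++ v))).drop (Nat.size m + 1) =
      u ++ v := by
    rw [List.drop_append]
    simp
  simp only [parseHeader, h1, h2]
  simp [← hu, hm]

/-! ### Weighted enumeration of words -/

section Enumeration

variable {V : Type*} [Fintype V] {r : ℕ}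

/-- Extends every word by one letter, multiplying its weight by the weight `q u v` of the new
letter `v` in the context `u` of the earlier letters at the positions in `row`. -/
noncomputable def enumStep (q : (Fin r → Option V) × V → ℕ) (acc : List (List V × ℕ))
    (row : Fin r → ℕ) : List (List V × ℕ) :=
  acc.flatMap fun p => (Finset.univ : Finset V).toList.map fun v =>
    (p.1 ++ [v], p.2 * q (fun l => p.1[row l]?, v))

/-- All words of the length of `T`, with their weights. -/
noncomputable def enumWeights (q : (Fin r → Option V) × V → ℕ) (T : List (Fin r → ℕ)) :
    List (List V × ℕ) :=
  T.foldl (enumStep q) [([], 1)]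

theorem sum_enumStep_le {q : (Fin r → Option V) × V → ℕ} {N : ℕ}
    (hq : ∀ u, ∑ v, q (u, v) ≤ N) (acc : List (List V × ℕ)) (row : Fin r → ℕ) :
    ((enumStep q acc row).map Prod.snd).sum ≤ (acc.map Prod.snd).sum * N := by
  induction acc with
  | nil => simp [enumStep]
  | cons p acc ih =>
    have : enumStep q (p :: acc) row = ((Finset.univ : Finset V).toList.map fun v =>
        (p.1 ++ [v], p.2 * q (fun l => p.1[row l]?, v))) ++ enumStep q acc row := by
      simp [enumStep]
    rw [this, List.map_append, List.sum_append, List.map_cons, List.sum_cons, add_mul]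
    refine add_le_add ?_ ih
    rw [List.map_map]
    have h2 : (List.map (Prod.snd ∘ fun v => (p.1 ++ [v], p.2 * q (fun l => p.1[row l]?, v)))
        (Finset.univ : Finset V).toList).sum = ∑ v, p.2 * q (fun l => p.1[row l]?, v) := by
      rw [← Finset.sum_map_toList]; rfl
    rw [h2, ← Finset.mul_sum]
    exact Nat.mul_le_mul_left _ (hq _)

/-- Kraft's inequality for the code: each new letter multiplies the total weight by at most `N`,
whatever context the row selects. -/
theorem sum_enumWeights_le {q : (Fin r → Option V) × V → ℕ} {N : ℕ}
    (hq : ∀ u, ∑ v, q (u, v) ≤ N) (T : List (Fin r → ℕ)) :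
    ((enumWeights q T).map Prod.snd).sum ≤ N ^ T.length := by
  induction T using List.reverseRecOn with
  | nil => simp [enumWeights]
  | append_singleton T row ih =>
    have : enumWeights q (T ++ [row]) = enumStep q (enumWeights q T) row := by
      simp [enumWeights]
    rw [this]
    refine (sum_enumStep_le hq _ _).trans ?_
    simpa [pow_succ] using Nat.mul_le_mul_right N ih

/-- When letter `i` is appended the word has length `i`, so a lookup at position `i` or later
returns `none`; only earlier letters can serve as context. -/
theorem mem_enumWeights (q : (Fin r → Option V) × V → ℕ) (row : ℕ → Fin r → ℕ) (v : ℕ → V)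
    (n : ℕ) :
    ((List.range n).map v, ∏ i ∈ Finset.range n,
      q (fun l => if row i l < i then some (v (row i l)) else none, v i)) ∈
      enumWeights q ((List.range n).map row) := by
  induction n with
  | zero => simp [enumWeights]
  | succ n ih =>
    have : enumWeights q ((List.range (n + 1)).map row) =
        enumStep q (enumWeights q ((List.range n).map row)) (row n) := by
      simp [enumWeights, List.range_succ]
    rw [this, enumStep, List.mem_flatMap]
    refine ⟨_, ih, List.mem_map.2 ⟨v n, by simp, ?_⟩⟩
    rw [Finset.prod_range_succ, List.range_succ, List.map_append]
    have hrow : ∀ l, ((List.range n).map v)[row n l]? =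
        if row n l < n then some (v (row n l)) else none := by
      intro l
      rw [List.getElem?_map]
      split_ifs with h
      · simp [List.getElem?_range h]
      · rw [List.getElem?_eq_none (by simpa using h)]; rfl
    simp only [hrow, List.map_cons, List.map_nil]

/-- Markov's inequality for counting, in integer form. -/
theorem length_filter_mul_le {α : Type*} (L : List (α × ℕ)) (a b : ℕ) :
    (L.filter fun p => decide (a ≤ b * p.2)).length * a ≤ b * (L.map Prod.snd).sum := by
  induction L with
  | nil => simp
  | cons p L ih =>
    rw [List.filter_cons, List.map_cons, List.sum_cons, mul_add]
    split_ifs with h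
    · rw [List.length_cons, add_mul, one_mul, add_comm]
      exact add_le_add (by simpa using h) ih
    · exact ih.trans (Nat.le_add_left _ _)

/-- The word with index `idx` among the words of weight at least `N ^ n / 2 ^ |idx|`. -/
noncomputable def decodeWord (q : (Fin r → Option V) × V → ℕ) (N : ℕ) (word : V → List Bool)
    (T : List (Fin r → ℕ)) (idx : List Bool) : List Bool :=
  (((enumWeights q T).filter fun p => decide (N ^ T.length ≤ 2 ^ idx.length * p.2)).getD
    (binVal idx) ([], 0)).1.flatMap word

/-- By Kraft and Markov at most `2 ^ κ` words pass the weight threshold, so an index of `κ` bits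
suffices. The threshold is read off the length of the index, so `κ` itself is never transmitted. -/
theorem exists_decodeWord_eq {q : (Fin r → Option V) × V → ℕ} {N : ℕ} (hN : 0 < N)
    (hq : ∀ u, ∑ v, q (u, v) ≤ N) (word : V → List Bool) (T : List (Fin r → ℕ))
    (p : List V × ℕ) (hp : p ∈ enumWeights q T) (κ : ℕ) (hκ : N ^ T.length ≤ 2 ^ κ * p.2) :
    ∃ idx : List Bool, idx.length = κ ∧ decodeWord q N word T idx = p.1.flatMap word := by
  set L := (enumWeights q T).filter fun p => decide (N ^ T.length ≤ 2 ^ κ * p.2) with hL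
  have hpL : p ∈ L := by simp [hL, hp, hκ]
  have hlen : L.length ≤ 2 ^ κ := by
    have := (length_filter_mul_le (enumWeights q T) (N ^ T.length) (2 ^ κ)).trans
      (Nat.mul_le_mul_left _ (sum_enumWeights_le hq T))
    exact Nat.le_of_mul_le_mul_right this (pow_pos hN _)
  obtain ⟨i, hi, rfl⟩ := List.getElem_of_mem hpL
  obtain ⟨idx, hidx, hval⟩ := exists_binVal_eq κ i (hi.trans_le hlen)
  refine ⟨idx, hidx, ?_⟩
  simp only [decodeWord, hidx, ← hL, hval]
  rw [List.getD_eq_getElem _ _ hi]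

theorem primrec_enumWeights [Primcodable V] (q : (Fin r → Option V) × V → ℕ) :
    Primrec (enumWeights q) := by
  have hctx : Primrec fun x : List V × (Fin r → ℕ) => fun l => x.1[x.2 l]? := by
    refine Primrec.fin_curry.2 (Primrec.list_getElem?.comp (Primrec.fst.comp Primrec.fst) ?_)
    exact Primrec.fin_app.comp (Primrec.snd.comp Primrec.fst) Primrec.snd
  have hstep : Primrec fun x : List (List V × ℕ) × (Fin r → ℕ) => enumStep q x.1 x.2 := by
    refine Primrec.list_flatMap Primrec.fst ?_
    refine Primrec.list_map (Primrec.const _) ?_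
    refine Primrec.pair ?_ ?_
    · exact Primrec.list_concat.comp
        (Primrec.fst.comp (Primrec.snd.comp Primrec.fst)) Primrec.snd
    · refine Primrec.nat_mul.comp (Primrec.snd.comp (Primrec.snd.comp Primrec.fst)) ?_
      refine (Primrec.dom_finite q).comp (Primrec.pair ?_ Primrec.snd)
      exact hctx.comp (Primrec.pair (Primrec.fst.comp (Primrec.snd.comp Primrec.fst))
        (Primrec.snd.comp (Primrec.fst.comp Primrec.fst)))
  exact Primrec.list_foldl (h := fun _ p => enumStep q p.1 p.2) Primrec.id (Primrec.const _)
    (hstep.comp Primrec.snd)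

theorem primrec_pow : Primrec₂ ((· ^ ·) : ℕ → ℕ → ℕ) :=
  Primrec₂.unpaired'.1 Nat.Primrec.pow

/-- The tables `q` and `word` have finite domain, hence are primitive recursive however they were
obtained. -/
theorem primrec_decodeWord [Primcodable V] (q : (Fin r → Option V) × V → ℕ) (N : ℕ)
    (word : V → List Bool) :
    Primrec fun x : List (Fin r → ℕ) × List Bool => decodeWord q N word x.1 x.2 := by
  have hfilter : Primrec fun x : List (Fin r → ℕ) × List Bool =>
      (enumWeights q x.1).filter fun p => decide (N ^ x.1.length ≤ 2 ^ x.2.length * p.2) := by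
    have h : Primrec fun x : List (Fin r → ℕ) × List Bool => (enumWeights q x.1).filterMap
        fun p => if N ^ x.1.length ≤ 2 ^ x.2.length * p.2 then some p else none := by
      refine Primrec.listFilterMap ((primrec_enumWeights q).comp Primrec.fst) ?_
      refine Primrec.ite (Primrec.nat_le.comp ?_ ?_) (Primrec.option_some.comp Primrec.snd)
        (Primrec.const none)
      · exact primrec_pow.comp (Primrec.const N)
          (Primrec.list_length.comp (Primrec.fst.comp Primrec.fst))
      · exact Primrec.nat_mul.comp (primrec_pow.comp (Primrec.const 2)
          (Primrec.list_length.comp (Primrec.snd.comp Primrec.fst)))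
          (Primrec.snd.comp Primrec.snd)
    refine h.of_eq fun x => ?_
    rw [← List.filterMap_eq_filter]
    congr 1
    funext p
    simp [Option.guard]
  refine Primrec.list_flatMap (Primrec.fst.comp ((Primrec.list_getD _).comp hfilter
    (primrec_binVal.comp Primrec.snd))) ((Primrec.dom_finite word).comp Primrec.snd)

end Enumeration

theorem complexityOf_le {D : List Bool →. List Bool} {x w : List Bool} (h : x ∈ D w) :
    complexityOf D x ≤ w.length :=
  iInf₂_le w h

theorem IsOptimal.complexityOf_le_of_weight {O : ℕ → ℕ} {D : List Bool →. List Bool}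
    (hD : IsOptimal O D) {V : Type*} [Fintype V] [Primcodable V] {r : ℕ}
    {T : ℕ → List (Fin r → ℕ)} (hT : ComputableIn {(O : ℕ →. ℕ)} T)
    {q : (Fin r → Option V) × V → ℕ} {N : ℕ} (hN : 0 < N) (hq : ∀ u, ∑ v, q (u, v) ≤ N)
    (word : V → List Bool) :
    ∃ c : ℕ, ∀ m κ : ℕ, ∀ p ∈ enumWeights q (T m), N ^ (T m).length ≤ 2 ^ κ * p.2 →
      complexityOf D (p.1.flatMap word) ≤ (κ + 2 * Nat.size m + c : ℕ) := by
  have h1 : ComputableIn {(O : ℕ →. ℕ)} fun w => (parseHeader w).1 :=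
    (Primrec.fst.comp primrec_parseHeader).computableIn
  have h2 : ComputableIn {(O : ℕ →. ℕ)} fun w => (parseHeader w).2 :=
    (Primrec.snd.comp primrec_parseHeader).computableIn
  have h3 : ComputableIn {(O : ℕ →. ℕ)} fun w => (T (parseHeader w).1, (parseHeader w).2) :=
    (hT.comp h1).pair h2
  have h4 := (primrec_decodeWord q N word).computableIn (O := {(O : ℕ →. ℕ)})
  obtain ⟨G, hG, hGdec⟩ : ∃ G : List Bool → List Bool, ComputableIn {(O : ℕ →. ℕ)} G ∧
      ∀ w, G w = decodeWord q N word (T (parseHeader w).1) (parseHeader w).2 :=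
    ⟨_, ComputableIn.comp h4 h3, fun _ => rfl⟩
  obtain ⟨c, hc⟩ := hD.minorizes _ hG
  -- The `1` is the separator bit of the header.
  refine ⟨1 + c, fun m κ p hp hκ => (hc _).trans ?_⟩
  obtain ⟨idx, hidx, hdec⟩ := exists_decodeWord_eq hN hq word (T m) p hp κ hκ
  obtain ⟨w, hw, hpw⟩ := exists_parseHeader_eq m idx
  have := complexityOf_le (D := fun w => Part.some (G w)) (w := w) (x := p.1.flatMap word)
    (by rw [hGdec, hpw, hdec]; exact Part.mem_some _)
  refine (add_le_add_left this _).trans (le_of_eq ?_)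
  rw [hw, hidx]
  push_cast
  ring

/-! ### Positions in finite sets -/

section Position

variable {Γ : Type*} [LinearOrder Γ]

/-- The number of elements of `Φ` below `γ`. -/
def position (Φ : Finset Γ) (γ : Γ) : ℕ := (Φ.filter (· < γ)).card

theorem position_orderEmbOfFin (Φ : Finset Γ) (i : Fin Φ.card) :
    position Φ (Φ.orderEmbOfFin rfl i) = i := by
  have : Φ.filter (· < Φ.orderEmbOfFin rfl i) =
      (Finset.Iio i).map (Φ.orderEmbOfFin rfl).toEmbedding := by
    ext γ
    simp only [Finset.mem_filter, Finset.mem_map, Finset.mem_Iio]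
    constructor
    · rintro ⟨h1, h2⟩
      have : γ ∈ Set.range (Φ.orderEmbOfFin rfl) := by simpa using h1
      obtain ⟨j, rfl⟩ := this
      exact ⟨j, by simpa using h2, rfl⟩
    · rintro ⟨j, hj, rfl⟩
      exact ⟨by simp, by simpa using hj⟩
  rw [position, this, Finset.card_map, Fin.card_Iio]

theorem exists_orderEmbOfFin_eq {Φ : Finset Γ} {γ : Γ} (h : γ ∈ Φ) :
    ∃ i : Fin Φ.card, Φ.orderEmbOfFin rfl i = γ := by
  have : γ ∈ Set.range (Φ.orderEmbOfFin rfl) := by simpa using h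
  exact this

theorem position_eq_iff {Φ : Finset Γ} {γ : Γ} (h : γ ∈ Φ) (i : Fin Φ.card) :
    position Φ γ = i ↔ γ = Φ.orderEmbOfFin rfl i := by
  obtain ⟨j, rfl⟩ := exists_orderEmbOfFin_eq h
  rw [position_orderEmbOfFin, Fin.val_inj, EmbeddingLike.apply_eq_iff_eq]

theorem position_lt_iff {Φ : Finset Γ} {γ : Γ} (h : γ ∈ Φ) (i : Fin Φ.card) :
    position Φ γ < i ↔ γ < Φ.orderEmbOfFin rfl i := by
  obtain ⟨j, rfl⟩ := exists_orderEmbOfFin_eq h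
  rw [position_orderEmbOfFin, OrderEmbedding.lt_iff_lt, Fin.lt_def]

theorem sum_range_ite_mem_eq {Φ : Finset Γ} (e : Γ ≃ ℕ) {k : ℕ} (hk : ∀ γ ∈ Φ, e γ < k)
    (g : ℕ → ℕ) :
    ∑ b ∈ Finset.range k, (if e.symm b ∈ Φ then g b else 0) = ∑ γ ∈ Φ, g (e γ) := by
  rw [← Finset.sum_filter]
  refine Finset.sum_bij' (fun b _ => e.symm b) (fun γ _ => e γ) ?_ ?_ ?_ ?_ ?_
  all_goals simp +contextual [hk]

/-- Once as many members as `|Φ|` have been counted, none is left. Thus knowing the cardinality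
turns decidable membership into a computable bound on the codes. -/
theorem lt_of_sum_range_eq_card {Φ : Finset Γ} (e : Γ ≃ ℕ) {k : ℕ}
    (hk : ∑ b ∈ Finset.range k, (if e.symm b ∈ Φ then 1 else 0) = Φ.card) :
    ∀ γ ∈ Φ, e γ < k := by
  rw [← Finset.sum_filter, ← Finset.card_eq_sum_ones] at hk
  have : ((Finset.range k).filter (e.symm · ∈ Φ)).map e.symm.toEmbedding = Φ := by
    refine Finset.eq_of_subset_of_card_le (fun γ hγ => ?_) (by rw [Finset.card_map, hk])
    obtain ⟨b, hb, rfl⟩ := Finset.mem_map.1 hγ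
    exact (Finset.mem_filter.1 hb).2
  intro γ hγ
  rw [← this] at hγ
  obtain ⟨b, hb, rfl⟩ := Finset.mem_map.1 hγ
  simpa using (Finset.mem_filter.1 hb).1

end Position

theorem IsSuitableOracle.exists_computableIn_rows {Γ : Type*} [Group Γ] [LinearOrder Γ]
    {O : ℕ → ℕ} {e : Γ ≃ ℕ} {Φ : ℕ → Finset Γ} (hO : IsSuitableOracle O e Φ) {r : ℕ}
    (t : Fin r → Γ) :
    ∃ T : ℕ → List (Fin r → ℕ), ComputableIn {(O : ℕ →. ℕ)} T ∧
      ∀ m, ∃ row : ℕ → Fin r → ℕ, T m = (List.range (Φ m).card).map row ∧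
        ∀ (i : Fin (Φ m).card) (l : Fin r), row i l =
          if t l * (Φ m).orderEmbOfFin rfl i ∈ Φ m then
            position (Φ m) (t l * (Φ m).orderEmbOfFin rfl i) else (Φ m).card := by
  obtain ⟨lt, hlt, hlt'⟩ := hO.lt
  obtain ⟨mem, hmem, hmem'⟩ := hO.mem
  have hcount : ComputableIn {(O : ℕ →. ℕ)} fun x : ℕ × ℕ =>
      ∑ b ∈ Finset.range x.2, if mem (b, x.1) = true then 1 else 0 :=
    ComputableIn.sum_range (f := fun y : (ℕ × ℕ) × ℕ => if mem (y.2, y.1.1) = true then 1 else 0)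
      (ComputableIn.ite (hmem.comp (Primrec.pair Primrec.snd
        (Primrec.fst.comp Primrec.fst)).computableIn) (.const 1) (.const 0)) .snd
  obtain ⟨k, hk, hkspec⟩ := ComputableIn.exists_search
    (hcount.beq (hO.card.comp ComputableIn.fst)) (fun m => by
      refine ⟨(Φ m).sup e + 1, ?_⟩
      have h := sum_range_ite_mem_eq (Φ := Φ m) e (k := (Φ m).sup e + 1)
        (fun γ hγ => Nat.lt_succ_of_le (Finset.le_sup (f := e) hγ)) fun _ => 1
      simp only [hmem', decide_eq_true_eq]
      simpa using h)
  have hkm : ∀ m, ∀ γ ∈ Φ m, e γ < k m := fun m =>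
    lt_of_sum_range_eq_card e (by simpa [hmem'] using hkspec m)
  let pos : ℕ × ℕ → ℕ := fun x =>
    ∑ b ∈ Finset.range (k x.1), if (mem (b, x.1) && lt (b, x.2)) = true then 1 else 0
  have hpos : ComputableIn {(O : ℕ →. ℕ)} pos :=
    ComputableIn.sum_range (f := fun y : (ℕ × ℕ) × ℕ =>
        if (mem (y.2, y.1.1) && lt (y.2, y.1.2)) = true then 1 else 0)
      (ComputableIn.ite ((hmem.comp (Primrec.pair Primrec.snd
        (Primrec.fst.comp Primrec.fst)).computableIn).and (hlt.comp (Primrec.pair Primrec.snd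
        (Primrec.snd.comp Primrec.fst)).computableIn)) (.const 1) (.const 0)) (hk.comp .fst)
  have hpos' : ∀ m γ, pos (m, e γ) = position (Φ m) γ := by
    intro m γ
    have := sum_range_ite_mem_eq (Φ := Φ m) e (hkm m) fun b => if e.symm b < γ then 1 else 0
    simp only [Equiv.symm_apply_apply] at this
    rw [position, Finset.card_filter, ← this]
    simp only [pos, Bool.and_eq_true, hmem', hlt', Equiv.symm_apply_apply, ite_and]
  -- The inverse of `pos`: for a valid position the sum has only one possibly nonzero term, the code
  -- of the element there.
  let elt : ℕ × ℕ → ℕ := fun x =>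
    ∑ b ∈ Finset.range (k x.1), if (mem (b, x.1) && decide (pos (x.1, b) = x.2)) = true
      then b else 0
  have helt : ComputableIn {(O : ℕ →. ℕ)} elt :=
    ComputableIn.sum_range (f := fun y : (ℕ × ℕ) × ℕ =>
        if (mem (y.2, y.1.1) && decide (pos (y.1.1, y.2) = y.1.2)) = true then y.2 else 0)
      (ComputableIn.ite ((hmem.comp (Primrec.pair Primrec.snd
        (Primrec.fst.comp Primrec.fst)).computableIn).and
          ((hpos.comp (Primrec.pair (Primrec.fst.comp Primrec.fst) Primrec.snd).computableIn).beq
            (Primrec.snd.comp Primrec.fst).computableIn)) .snd (.const 0)) (hk.comp .fst)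
  have helt' : ∀ m (i : Fin (Φ m).card), elt (m, i) = e ((Φ m).orderEmbOfFin rfl i) := by
    intro m i
    have := sum_range_ite_mem_eq (Φ := Φ m) e (hkm m)
      fun b => if position (Φ m) (e.symm b) = i then b else 0
    simp only [Equiv.symm_apply_apply] at this
    have h2 : ∑ γ ∈ Φ m, (if position (Φ m) γ = i then e γ else 0) =
        e ((Φ m).orderEmbOfFin rfl i) := by
      rw [Finset.sum_eq_single ((Φ m).orderEmbOfFin rfl i), if_pos (position_orderEmbOfFin _ _)]
      · exact fun γ hγ hne => if_neg fun h => hne ((position_eq_iff hγ i).1 h)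
      · exact fun h => absurd (Finset.orderEmbOfFin_mem _ _ _) h
    rw [← h2, ← this]
    simp only [elt, Bool.and_eq_true, decide_eq_true_eq, hmem', ite_and]
    refine Finset.sum_congr rfl fun b _ => ?_
    rw [← hpos' m (e.symm b), Equiv.apply_symm_apply]
  let row : ℕ × ℕ → Fin r → ℕ := fun x l =>
    if mem (e (e.symm (e (t l)) * e.symm (elt x)), x.1) = true then
      pos (x.1, e (e.symm (e (t l)) * e.symm (elt x))) else (Φ x.1).card
  have hrow : ComputableIn {(O : ℕ →. ℕ)} row := by
    refine ComputableIn.pi_fin fun l => ?_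
    have hmul : ComputableIn {(O : ℕ →. ℕ)} fun x : ℕ × ℕ =>
        e (e.symm (e (t l)) * e.symm (elt x)) :=
      hO.mul.comp ((ComputableIn.const (e (t l))).pair helt)
    exact ComputableIn.ite (hmem.comp (hmul.pair .fst)) (hpos.comp (ComputableIn.pair .fst hmul))
      (hO.card.comp .fst)
  refine ⟨_, ComputableIn.map_range hrow hO.card, fun m => ⟨fun i => row (m, i), rfl, ?_⟩⟩
  intro i l
  simp only [row, helt', hmem', Equiv.symm_apply_apply, hpos']

/-! ### Weights of colorings of finite sets -/

section Context

variable {Γ : Type*} [Group Γ] [LinearOrder Γ] {V : Type*} {r : ℕ}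

/-- The colors under `w` of those points among the `t l * φ` that lie in `Φ` and below `φ`. -/
def context (Φ : Finset Γ) (t : Fin r → Γ) (w : Γ → V) (φ : Γ) : Fin r → Option V :=
  fun l => if t l * φ ∈ Φ ∧ t l * φ < φ then some (w (t l * φ)) else none

/-- The weight of the coloring `w` of `Φ`, the product of the weights of its letters in context. -/
def colorWeight (q : (Fin r → Option V) × V → ℕ) (Φ : Finset Γ) (t : Fin r → Γ) (w : Γ → V) : ℕ :=
  ∏ φ ∈ Φ, q (context Φ t w φ, w φ)

variable [Fintype V] [Inhabited V]

/-- Increasing order makes "below `φ`" the same as "already written". The value `Φ.card` marks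
points outside `Φ`: it is never an earlier position, so it reads as `none`. -/
theorem colorWeight_mem_enumWeights (q : (Fin r → Option V) × V → ℕ) (Φ : Finset Γ)
    (t : Fin r → Γ) (row : ℕ → Fin r → ℕ)
    (hrow : ∀ (i : Fin Φ.card) (l : Fin r), row i l =
      if t l * Φ.orderEmbOfFin rfl i ∈ Φ then position Φ (t l * Φ.orderEmbOfFin rfl i)
      else Φ.card) (w : Γ → V) :
    (List.ofFn fun i : Fin Φ.card => w (Φ.orderEmbOfFin rfl i), colorWeight q Φ t w) ∈
      enumWeights q ((List.range Φ.card).map row) := by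
  let v : ℕ → V := fun j => if h : j < Φ.card then w (Φ.orderEmbOfFin rfl ⟨j, h⟩) else default
  have hv : ∀ i : Fin Φ.card, v i = w (Φ.orderEmbOfFin rfl i) := fun i => by simp [v]
  have hvpos : ∀ γ ∈ Φ, v (position Φ γ) = w γ := fun γ hγ => by
    obtain ⟨j, rfl⟩ := exists_orderEmbOfFin_eq hγ
    rw [position_orderEmbOfFin, hv]
  have hmem := mem_enumWeights q row v Φ.card
  have h1 : (List.range Φ.card).map v =
      List.ofFn fun i : Fin Φ.card => w (Φ.orderEmbOfFin rfl i) := by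
    refine List.ext_getElem (by simp) fun j h1 h2 => ?_
    simp at h1
    simpa using hv ⟨j, h1⟩
  have h2 : ∏ i ∈ Finset.range Φ.card,
      q (fun l => if row i l < i then some (v (row i l)) else none, v i) =
      colorWeight q Φ t w := by
    rw [Finset.prod_range]
    have himg : Φ = Finset.univ.map (Φ.orderEmbOfFin rfl).toEmbedding := by
      simp
    rw [colorWeight]
    conv_rhs => rw [himg, Finset.prod_map]
    refine Finset.prod_congr rfl fun i _ => ?_
    have hctx : (fun l => if row i l < i then some (v (row i l)) else none) =
        context Φ t w (Φ.orderEmbOfFin rfl i) := by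
      funext l
      rw [context, hrow]
      by_cases hl : t l * Φ.orderEmbOfFin rfl i ∈ Φ
      · simp only [hl, if_true, true_and, position_lt_iff hl, hvpos _ hl]
      · simp only [hl, if_false, false_and]
        exact if_neg (not_lt.2 i.2.le)
    rw [hctx, hv, ← himg]
    rfl
  rwa [h1, h2] at hmem

end Context

theorem IsOptimal.complexityOf_wordOf_le {Γ : Type*} [Group Γ] [LinearOrder Γ]
    {O : ℕ → ℕ} {e : Γ ≃ ℕ} {Φ : ℕ → Finset Γ} (hO : IsSuitableOracle O e Φ)
    {D : List Bool →. List Bool} (hD : IsOptimal O D) {s r : ℕ} (t : Fin r → Γ)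
    {q : (Fin r → Option (Fin s → Bool)) × (Fin s → Bool) → ℕ} {N : ℕ} (hN : 0 < N)
    (hq : ∀ u, ∑ v, q (u, v) ≤ N) :
    ∃ c : ℕ, ∀ (m κ : ℕ) (w : Γ → Fin s → Bool),
      N ^ (Φ m).card ≤ 2 ^ κ * colorWeight q (Φ m) t w →
      complexityOf D (wordOf fun γ : Φ m => w γ) ≤ (κ + 2 * Nat.size m + c : ℕ) := by
  obtain ⟨T, hT, hrow⟩ := hO.exists_computableIn_rows t
  obtain ⟨c, hc⟩ := hD.complexityOf_le_of_weight hT hN hq List.ofFn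
  refine ⟨c, fun m κ w hκ => ?_⟩
  obtain ⟨row, hTm, hspec⟩ := hrow m
  have := hc m κ _ (hTm ▸ colorWeight_mem_enumWeights q (Φ m) t row hspec w)
    (by simpa [hTm] using hκ)
  convert this using 2
  rw [wordOf, List.flatMap, List.map_ofFn]
  rfl

/-- Distinct colorings give distinct entries of the enumeration, so Kraft's inequality applies. Any
extension `E` to `Γ` will do, since weights look only inside `Φ`. -/
theorem sum_colorWeight_le {Γ : Type*} [Group Γ] [LinearOrder Γ] {V : Type*} [Fintype V]
    [Inhabited V] {r : ℕ} (Φ : Finset Γ) (t : Fin r → Γ)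
    {q : (Fin r → Option V) × V → ℕ} {N : ℕ} (hq : ∀ u, ∑ v, q (u, v) ≤ N)
    (E : (Φ → V) → Γ → V) (hE : ∀ w (γ : Φ), E w γ = w γ) :
    ∑ w : Φ → V, colorWeight q Φ t (E w) ≤ N ^ Φ.card := by
  classical
  let row : ℕ → Fin r → ℕ := fun i l => if h : i < Φ.card then
      if t l * Φ.orderEmbOfFin rfl ⟨i, h⟩ ∈ Φ then position Φ (t l * Φ.orderEmbOfFin rfl ⟨i, h⟩)
      else Φ.card else 0
  have hmem := colorWeight_mem_enumWeights q Φ t row fun i l => by simp [row]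
  let L := enumWeights q ((List.range Φ.card).map row)
  let ι : (Φ → V) → List V × ℕ := fun w =>
    (List.ofFn fun i : Fin Φ.card => E w (Φ.orderEmbOfFin rfl i), colorWeight q Φ t (E w))
  have hι : Function.Injective ι := by
    intro w w' h
    have h1 := List.ofFn_injective (congrArg Prod.fst h)
    funext γ
    obtain ⟨i, hi⟩ := exists_orderEmbOfFin_eq γ.2
    have := congrFun h1 i
    simpa only [hi, hE] using this
  have hle : (Finset.univ.image ι).val ≤ (L : Multiset (List V × ℕ)) := by
    refine (Multiset.le_iff_subset (Finset.nodup _)).2 fun p hp => ?_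
    obtain ⟨w, -, rfl⟩ := Finset.mem_image.1 hp
    exact hmem (E w)
  calc ∑ w : Φ → V, colorWeight q Φ t (E w) = ∑ p ∈ Finset.univ.image ι, p.2 := by
        rw [Finset.sum_image hι.injOn]
    _ ≤ (Multiset.map Prod.snd (L : Multiset (List V × ℕ))).sum := by
        obtain ⟨u, hu⟩ := Multiset.le_iff_exists_add.1 hle
        rw [hu, Multiset.map_add, Multiset.sum_add]
        exact Nat.le_add_right _ _
    _ ≤ N ^ Φ.card := by
        simpa using sum_enumWeights_le hq ((List.range Φ.card).map row)

/-! ### Information functions -/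

section Information

set_option linter.unusedSectionVars false

variable {Γ X V : Type*} [Group Γ] [LinearOrder Γ] [MulAction Γ X]

/-- The points with the same colors as `x` along `A`. -/
def colorClass (f : X → V) (A : Finset Γ) (x : X) : Set X :=
  {y | ∀ γ ∈ A, f (γ • y) = f (γ • x)}

theorem colorClass_eq_preimage (f : X → V) (A : Finset Γ) (x : X) :
    colorClass f A x = coloringPow f A ⁻¹' {coloringPow f A x} := by
  ext y
  simp [colorClass, coloringPow, funext_iff]

theorem colorClass_anti (f : X → V) {A B : Finset Γ} (h : A ⊆ B) (x : X) :
    colorClass f B x ⊆ colorClass f A x := fun _ hy γ hγ => hy γ (h hγ)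

theorem colorClass_image_mul (f : X → V) (A : Finset Γ) (δ : Γ) (x : X) :
    colorClass f (A.image (· * δ)) x = (δ • ·) ⁻¹' colorClass f A (δ • x) := by
  ext y
  simp only [colorClass, Set.mem_ofPred_eq, Set.mem_preimage, Finset.forall_mem_image, mul_smul]

variable [MeasurableSpace X] (μ : Measure X)

/-- The information function of the coloring `f` along `A`. -/
noncomputable def info (f : X → V) (A : Finset Γ) (x : X) : ℝ :=
  -Real.logb 2 (μ.real (colorClass f A x))

/-- Positivity excludes the convention `Real.logb 2 0 = 0`, under which a null class would carry no
information. -/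
theorem info_mono [IsFiniteMeasure μ] {f : X → V} {A B : Finset Γ} (h : A ⊆ B) {x : X}
    (hx : 0 < μ.real (colorClass f B x)) : info μ f A x ≤ info μ f B x :=
  neg_le_neg (Real.logb_le_logb_of_le one_lt_two hx (measureReal_mono (colorClass_anti f h x)))

theorem info_empty [IsProbabilityMeasure μ] (f : X → V) (x : X) : info μ f (∅ : Finset Γ) x = 0 := by
  simp [info, colorClass]

variable [MeasurableSpace V] [MeasurableSingletonClass V] [Fintype V]
  [MeasurableConstSMul Γ X] {f : X → V}

theorem measurable_coloringPow (hf : Measurable f) (A : Finset Γ) :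
    Measurable (coloringPow f A : X → (A → V)) :=
  measurable_pi_iff.2 fun γ => hf.comp (measurable_const_smul (γ : Γ))

theorem measurableSet_colorClass (hf : Measurable f) (A : Finset Γ) (x : X) :
    MeasurableSet (colorClass f A x) := by
  rw [colorClass_eq_preimage]
  exact measurable_coloringPow hf A (measurableSet_singleton _)

theorem integrable_comp_coloringPow [IsFiniteMeasure μ] (hf : Measurable f) (A : Finset Γ)
    (G : (A → V) → ℝ) : Integrable (fun x => G (coloringPow f A x)) μ :=
  (Integrable.of_finite (μ := μ.map (coloringPow f A)) (f := G)).comp_measurable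
    (measurable_coloringPow hf A)

theorem integral_comp_coloringPow [IsFiniteMeasure μ] (hf : Measurable f) (A : Finset Γ)
    (G : (A → V) → ℝ) :
    ∫ x, G (coloringPow f A x) ∂μ = ∑ w, μ.real (coloringPow f A ⁻¹' {w}) * G w := by
  rw [← integral_map (φ := coloringPow f A) (f := G) (measurable_coloringPow hf A).aemeasurable
    (Measurable.of_discrete).aestronglyMeasurable, integral_fintype Integrable.of_finite]
  refine Finset.sum_congr rfl fun w _ => ?_
  rw [map_measureReal_apply (measurable_coloringPow hf A) (measurableSet_singleton _), smul_eq_mul]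

theorem integrable_info [IsFiniteMeasure μ] (hf : Measurable f) (A : Finset Γ) :
    Integrable (info μ f A) μ := by
  have := integrable_comp_coloringPow μ hf A
    fun w => -Real.logb 2 (μ.real (coloringPow f A ⁻¹' {w}))
  simp only [← colorClass_eq_preimage] at this
  exact this

theorem integral_info [IsFiniteMeasure μ] (hf : Measurable f) (A : Finset Γ) :
    ∫ x, info μ f A x ∂μ = shannonEntropy μ (coloringPow f A) := by
  have := integral_comp_coloringPow μ hf A
    fun w => -Real.logb 2 (μ.real (coloringPow f A ⁻¹' {w}))
  simp only [← colorClass_eq_preimage] at this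
  simp only [info, this, shannonEntropy, mul_neg, Finset.sum_neg_distrib]

/-- There are countably many finite sets and finitely many patterns on each, so discarding all null
patterns costs a null set. -/
theorem ae_forall_colorClass_pos [Countable Γ] [IsFiniteMeasure μ] (f : X → V) :
    ∀ᵐ x ∂μ, ∀ A : Finset Γ, 0 < μ.real (colorClass f A x) := by
  rw [ae_all_iff]
  intro A
  have h : ∀ w : A → V, ∀ᵐ x ∂μ, coloringPow f A x = w →
      0 < μ.real (coloringPow f A ⁻¹' {w}) := by
    intro w
    by_cases hw : μ (coloringPow f A ⁻¹' {w}) = 0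
    · filter_upwards [measure_eq_zero_iff_ae_notMem.1 hw] with x hx h
      exact absurd h hx
    · exact .of_forall fun x _ => ENNReal.toReal_pos hw (measure_ne_top _ _)
  filter_upwards [ae_all_iff.2 h] with x hx
  rw [colorClass_eq_preimage]
  exact hx _ rfl

theorem info_image_mul [SMulInvariantMeasure Γ X μ] (hf : Measurable f) (A : Finset Γ) (δ : Γ)
    (x : X) : info μ f (A.image (· * δ)) x = info μ f A (δ • x) := by
  rw [info, info, colorClass_image_mul, measureReal_def, measureReal_def,
    measure_preimage_smul_of_nullMeasurableSet]
  exact (measurableSet_colorClass hf A _).nullMeasurableSet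

end Information

/-! ### Conditional information along a finite set -/

/-- The chain rule, with the points revealed in increasing order. -/
theorem Finset.sum_filter_lt_telescope {Γ : Type*} [LinearOrder Γ] (G : Finset Γ → ℝ)
    (B : Finset Γ) :
    ∑ φ ∈ B, (G (insert φ (B.filter (· < φ))) - G (B.filter (· < φ))) = G B - G ∅ := by
  induction B using Finset.induction_on_max with
  | empty => simp
  | insert a B ha ih =>
    have haB : a ∉ B := fun h => lt_irrefl _ (ha a h)
    rw [Finset.sum_insert haB]
    have h1 : (insert a B).filter (· < a) = B := by
      rw [Finset.filter_insert, if_neg (lt_irrefl _), Finset.filter_true_of_mem ha]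
    have h2 : ∀ φ ∈ B, (insert a B).filter (· < φ) = B.filter (· < φ) := fun φ hφ => by
      rw [Finset.filter_insert, if_neg (ha φ hφ).not_gt]
    rw [h1, Finset.sum_congr rfl fun φ hφ => by rw [h2 φ hφ], ih]
    ring

section ConditionalInformation

set_option linter.unusedSectionVars false

variable {Γ X V : Type*} [Group Γ] [LinearOrder Γ] {r : ℕ}

/-- The points of `Φ` below `φ` among the `t l * φ`. -/
def past (Φ : Finset Γ) (t : Fin r → Γ) (φ : Γ) : Finset Γ :=
  Φ.filter fun ψ => ψ < φ ∧ ∃ l, t l * φ = ψ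

variable [MulAction Γ X] [MeasurableSpace X] (μ : Measure X)

/-- The total information of the colors along `Φ`, each given its past. -/
noncomputable def condInfo (f : X → V) (Φ : Finset Γ) (t : Fin r → Γ) (x : X) : ℝ :=
  ∑ φ ∈ Φ, (info μ f (insert φ (past Φ t φ)) x - info μ f (past Φ t φ) x)

/-- The translates `h * g⁻¹`, `h ∈ F`. -/
noncomputable def translates (F : Finset Γ) (g : Γ) (l : Fin F.card) : Γ :=
  F.equivFin.symm l * g⁻¹

theorem past_translates (Φ F : Finset Γ) (g φ : Γ) :
    past Φ (translates F g) φ = (Φ ∩ F.image (· * (g⁻¹ * φ))).filter (· < φ) := by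
  ext ψ
  rw [past, Finset.mem_filter, Finset.mem_filter, Finset.mem_inter, Finset.mem_image]
  simp only [translates]
  constructor
  · rintro ⟨h1, h2, l, rfl⟩
    exact ⟨⟨h1, F.equivFin.symm l, (F.equivFin.symm l).2, by group⟩, h2⟩
  · rintro ⟨⟨h1, h, hF, rfl⟩, h2⟩
    exact ⟨h1, h2, F.equivFin ⟨h, hF⟩, by simp [mul_assoc]⟩

/-- Put `δ = g⁻¹ * φ`. The past of `φ` for the parameter `g` is the part of the window `Φ ∩ F * δ`
below `φ = g * δ`. Regrouping the pairs `(g, φ)` by `δ` therefore collects exactly the chain rule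
terms of each window. -/
theorem sum_condInfo_translates [IsProbabilityMeasure μ] (f : X → V) (Φ F : Finset Γ) (x : X) :
    ∑ g ∈ F, condInfo μ f Φ (translates F g) x =
      ∑ δ ∈ F⁻¹ * Φ, info μ f (Φ ∩ F.image (· * δ)) x := by
  have h1 : ∀ δ ∈ F⁻¹ * Φ, info μ f (Φ ∩ F.image (· * δ)) x =
      ∑ φ ∈ Φ ∩ F.image (· * δ),
        (info μ f (insert φ ((Φ ∩ F.image (· * δ)).filter (· < φ))) x -
          info μ f ((Φ ∩ F.image (· * δ)).filter (· < φ)) x) := fun δ _ => by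
    rw [Finset.sum_filter_lt_telescope (fun A => info μ f A x), info_empty, sub_zero]
  rw [Finset.sum_congr rfl h1]
  simp only [condInfo, past_translates]
  rw [Finset.sum_sigma', Finset.sum_sigma']
  refine Finset.sum_bij' (fun p _ => ⟨p.1⁻¹ * p.2, p.2⟩) (fun p _ => ⟨p.2 * p.1⁻¹, p.2⟩)
    ?_ ?_ ?_ ?_ ?_
  · rintro ⟨g, φ⟩ h
    simp only [Finset.mem_sigma] at h
    simp only [Finset.mem_sigma, Finset.mem_inter, Finset.mem_image]
    exact ⟨Finset.mul_mem_mul (Finset.inv_mem_inv h.1) h.2, h.2, g, h.1, by group⟩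
  · rintro ⟨δ, φ⟩ h
    simp only [Finset.mem_sigma, Finset.mem_inter, Finset.mem_image] at h
    obtain ⟨-, h2, g, hg, rfl⟩ := h
    simp only [Finset.mem_sigma]
    exact ⟨by simpa using hg, h2⟩
  · rintro ⟨g, φ⟩ _
    simp
  · rintro ⟨δ, φ⟩ _
    simp
  · rintro ⟨g, φ⟩ _
    simp

variable [MeasurableSpace V] [MeasurableSingletonClass V] [Fintype V]
  [MeasurableConstSMul Γ X] {f : X → V}

theorem integrable_condInfo [IsFiniteMeasure μ] (hf : Measurable f) (Φ : Finset Γ)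
    (t : Fin r → Γ) : Integrable (condInfo μ f Φ t) μ :=
  integrable_finsetSum _ fun _ _ => (integrable_info μ hf _).sub (integrable_info μ hf _)

theorem condInfo_nonneg [IsFiniteMeasure μ] (Φ : Finset Γ) (t : Fin r → Γ) {x : X}
    (hx : ∀ A : Finset Γ, 0 < μ.real (colorClass f A x)) : 0 ≤ condInfo μ f Φ t x :=
  Finset.sum_nonneg fun _ _ => sub_nonneg.2 (info_mono μ (Finset.subset_insert _ _) (hx _))

theorem sum_integral_condInfo_le [Countable Γ] [IsProbabilityMeasure μ]
    [SMulInvariantMeasure Γ X μ] (hf : Measurable f) (Φ F : Finset Γ) :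
    ∑ g ∈ F, ∫ x, condInfo μ f Φ (translates F g) x ∂μ ≤
      (F⁻¹ * Φ).card * shannonEntropy μ (coloringPow f F) := by
  rw [← integral_finsetSum _ fun g _ => integrable_condInfo μ hf Φ _]
  have hint : ∀ δ : Γ, Integrable (fun x => info μ f F (δ • x)) μ := fun δ => by
    simpa only [← info_image_mul μ hf F δ] using integrable_info μ hf (F.image (· * δ))
  have hval : ∀ δ : Γ, ∫ x, info μ f F (δ • x) ∂μ = shannonEntropy μ (coloringPow f F) :=
    fun δ => by rw [integral_smul_eq_self, integral_info μ hf]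
  calc ∫ x, ∑ g ∈ F, condInfo μ f Φ (translates F g) x ∂μ
      ≤ ∫ x, ∑ δ ∈ F⁻¹ * Φ, info μ f F (δ • x) ∂μ := by
        refine integral_mono_ae (integrable_finsetSum _ fun g _ => integrable_condInfo μ hf Φ _)
          (integrable_finsetSum _ fun δ _ => hint δ) ?_
        filter_upwards [ae_forall_colorClass_pos (Γ := Γ) μ f] with x hx
        rw [sum_condInfo_translates]
        refine Finset.sum_le_sum fun δ _ => ?_
        rw [← info_image_mul μ hf]
        exact info_mono μ Finset.inter_subset_right (hx _)
    _ = _ := by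
        rw [integral_finsetSum _ fun δ _ => hint δ, Finset.sum_congr rfl fun δ _ => hval δ,
          Finset.sum_const, nsmul_eq_mul]

end ConditionalInformation

/-! ### Letter weights from conditional probabilities -/

section LetterWeight

set_option linter.unusedSectionVars false

variable {Γ X V : Type*} [Group Γ] [LinearOrder Γ] [MulAction Γ X] [MeasurableSpace X]
  (μ : Measure X) {r : ℕ}

/-- The points whose colors at the `t l` agree with `u`, where `u` is defined. -/
def contextClass (f : X → V) (t : Fin r → Γ) (u : Fin r → Option V) : Set X :=
  {y | ∀ l a, u l = some a → f (t l • y) = a}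

/-- `M` times the conditional probability of the letter in the context, rounded up. -/
noncomputable def letterWeight (f : X → V) (t : Fin r → Γ) (M : ℕ)
    (p : (Fin r → Option V) × V) : ℕ :=
  ⌈(M : ℝ) * (μ.real (contextClass f t p.1 ∩ f ⁻¹' {p.2}) / μ.real (contextClass f t p.1))⌉₊

variable [MeasurableSpace V] [MeasurableSingletonClass V] [Fintype V]
  [MeasurableConstSMul Γ X] {f : X → V}

theorem measurableSet_contextClass (hf : Measurable f) (t : Fin r → Γ) (u : Fin r → Option V) :
    MeasurableSet (contextClass f t u) := by
  have : contextClass f t u = ⋂ l, ⋂ a, ⋂ (_ : u l = some a), (t l • ·) ⁻¹' (f ⁻¹' {a}) := by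
    ext y
    simp [contextClass]
  rw [this]
  exact .iInter fun l => .iInter fun a => .iInter fun _ =>
    measurable_const_smul (t l) (hf (measurableSet_singleton a))

/-- Rounding up adds at most one per letter. In a null context all quotients are `0`, which only
helps. -/
theorem sum_letterWeight_le [IsFiniteMeasure μ] (hf : Measurable f) (t : Fin r → Γ) (M : ℕ)
    (u : Fin r → Option V) :
    ∑ v, letterWeight μ f t M (u, v) ≤ M + Fintype.card V := by
  have hsum : ∑ v, μ.real (contextClass f t u ∩ f ⁻¹' {v}) = μ.real (contextClass f t u) := by
    rw [← measureReal_biUnion_finset]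
    · congr 1
      ext y
      simp
    · intro v _ v' _ hne
      refine Set.disjoint_left.2 fun y hy hy' => hne ?_
      rw [← hy.2, ← hy'.2]
    · exact fun v _ => (measurableSet_contextClass hf t u).inter
        (hf (measurableSet_singleton v))
  have h : ((∑ v, letterWeight μ f t M (u, v) : ℕ) : ℝ) ≤ M + Fintype.card V := by
    push_cast
    calc ∑ v, (letterWeight μ f t M (u, v) : ℝ)
        ≤ ∑ v, ((M : ℝ) * (μ.real (contextClass f t u ∩ f ⁻¹' {v}) /
            μ.real (contextClass f t u)) + 1) :=
          Finset.sum_le_sum fun v _ => (Nat.ceil_lt_add_one (by positivity)).le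
      _ = M * (μ.real (contextClass f t u) / μ.real (contextClass f t u)) +
            Fintype.card V := by
          rw [Finset.sum_add_distrib, ← Finset.mul_sum, ← Finset.sum_div, hsum]
          simp
      _ ≤ M + Fintype.card V := by
          have := div_self_le_one (μ.real (contextClass f t u))
          have hM : (0 : ℝ) ≤ M := by positivity
          nlinarith
  exact_mod_cast h

theorem preimage_contextClass_context (f : X → V) (Φ : Finset Γ) (t : Fin r → Γ) (φ : Γ)
    (x : X) :
    (φ • ·) ⁻¹' contextClass f t (context Φ t (fun γ => f (γ • x)) φ) =
      colorClass f (past Φ t φ) x := by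
  ext y
  simp only [contextClass, context, colorClass, past, Set.mem_preimage, Set.mem_ofPred_eq,
    Finset.mem_filter]
  constructor
  · rintro h γ ⟨h1, h2, l, rfl⟩
    have := h l (f ((t l * φ) • x)) (if_pos ⟨h1, h2⟩)
    simpa only [mul_smul] using this
  · intro h l a hl
    split_ifs at hl with hc
    rw [Option.some.injEq] at hl
    rw [← hl, ← mul_smul]
    exact h _ ⟨hc.1, hc.2, l, rfl⟩

theorem colorClass_insert (f : X → V) (A : Finset Γ) (φ : Γ) (x : X) :
    colorClass f (insert φ A) x = colorClass f A x ∩ (φ • ·) ⁻¹' (f ⁻¹' {f (φ • x)}) := by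
  ext y
  simp [colorClass, and_comm]

/-- Invariance moves the conditional probability at `φ` back to the identity, so one finite table
serves every `φ`. -/
theorem le_letterWeight [SMulInvariantMeasure Γ X μ] (hf : Measurable f) (Φ : Finset Γ)
    (t : Fin r → Γ) (M : ℕ) (φ : Γ) (x : X) :
    (M : ℝ) * (μ.real (colorClass f (insert φ (past Φ t φ)) x) /
      μ.real (colorClass f (past Φ t φ) x)) ≤
    letterWeight μ f t M (context Φ t (fun γ => f (γ • x)) φ, f (φ • x)) := by
  have hC := measurableSet_contextClass hf t (context Φ t (fun γ => f (γ • x)) φ)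
  have hv : MeasurableSet (f ⁻¹' {f (φ • x)}) := hf (measurableSet_singleton _)
  rw [colorClass_insert, ← preimage_contextClass_context, ← Set.preimage_inter,
    measureReal_def, measureReal_def,
    measure_preimage_smul_of_nullMeasurableSet (hC.inter hv).nullMeasurableSet,
    measure_preimage_smul_of_nullMeasurableSet hC.nullMeasurableSet]
  exact Nat.le_ceil _

theorem pow_card_le_mul_colorWeight [SMulInvariantMeasure Γ X μ] (hf : Measurable f)
    (Φ : Finset Γ) (t : Fin r → Γ) {M N : ℕ} (hM : 0 < M) (hN : 0 < N) {x : X}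
    (hx : ∀ A : Finset Γ, 0 < μ.real (colorClass f A x)) :
    (N : ℝ) ^ Φ.card ≤ 2 ^ (condInfo μ f Φ t x + Φ.card * Real.logb 2 (N / M)) *
      colorWeight (letterWeight μ f t M) Φ t fun γ => f (γ • x) := by
  have hM' : (0 : ℝ) < M := by exact_mod_cast hM
  have hN' : (0 : ℝ) < N := by exact_mod_cast hN
  have hexp : condInfo μ f Φ t x + Φ.card * Real.logb 2 (N / M) =
      ∑ φ ∈ Φ, (info μ f (insert φ (past Φ t φ)) x - info μ f (past Φ t φ) x +
        Real.logb 2 (N / M)) := by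
    rw [condInfo, Finset.sum_add_distrib, Finset.sum_const, nsmul_eq_mul]
  rw [hexp, Real.rpow_sum_of_pos two_pos, colorWeight, Nat.cast_prod, ← Finset.prod_mul_distrib,
    ← Finset.prod_const]
  refine Finset.prod_le_prod (fun _ _ => hN'.le) fun φ _ => ?_
  refine le_trans (le_of_eq ?_) (mul_le_mul_of_nonneg_left
    (le_letterWeight μ hf Φ t M φ x) (by positivity))
  rw [Real.rpow_add two_pos, Real.rpow_sub two_pos, info, info, Real.rpow_neg two_pos.le,
    Real.rpow_neg two_pos.le, Real.rpow_logb two_pos (by norm_num) (hx _),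
    Real.rpow_logb two_pos (by norm_num) (hx _),
    Real.rpow_logb two_pos (by norm_num) (by positivity)]
  have := (hx (insert φ (past Φ t φ))).ne'
  have := (hx (past Φ t φ)).ne'
  field_simp

/-! ### Entropy bounds -/

theorem colorWeight_congr (q : (Fin r → Option V) × V → ℕ) {Φ : Finset Γ} (t : Fin r → Γ)
    {w w' : Γ → V} (h : ∀ γ ∈ Φ, w γ = w' γ) : colorWeight q Φ t w = colorWeight q Φ t w' := by
  refine Finset.prod_congr rfl fun φ hφ => ?_
  have : context Φ t w φ = context Φ t w' φ := by
    funext l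
    unfold context
    split_ifs with hl
    · rw [h _ hl.1]
    · rfl
  rw [this, h φ hφ]

/-- Gibbs' inequality: the weights divided by `N ^ |Φ|` form a subprobability on colorings, and
coding with it cannot beat the entropy on average. -/
theorem shannonEntropy_le_integral_condInfo_add [Countable Γ] [Inhabited V]
    [IsProbabilityMeasure μ] [SMulInvariantMeasure Γ X μ] (hf : Measurable f) (Φ : Finset Γ)
    (t : Fin r → Γ) {M : ℕ} (hM : 0 < M) :
    shannonEntropy μ (coloringPow f Φ) ≤ ∫ x, condInfo μ f Φ t x ∂μ +
      Φ.card * Real.logb 2 ((M + Fintype.card V : ℕ) / M) := by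
  set N := M + Fintype.card V
  have hN : 0 < N := by omega
  have hN' : (0 : ℝ) < (N : ℝ) ^ Φ.card := by positivity
  set c := Φ.card * Real.logb 2 ((N : ℝ) / M)
  set q := letterWeight μ f t M
  let E : (Φ → V) → Γ → V := fun w γ => if h : γ ∈ Φ then w ⟨γ, h⟩ else default
  have hE : ∀ w (γ : Φ), E w γ = w γ := fun w γ => by simp [E]
  -- The likelihood ratio of the coding subprobability to the true distribution; its mean is at most
  -- 1, and `log R ≤ R - 1`.
  let R : (Φ → V) → ℝ := fun w =>
    colorWeight q Φ t (E w) / (N ^ Φ.card * μ.real (coloringPow f Φ ⁻¹' {w}))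
  have hlog : 0 < Real.log 2 := Real.log_pos one_lt_two
  have hR : ∫ x, (R (coloringPow f Φ x) - 1) / Real.log 2 ∂μ ≤ 0 := by
    have h1 : ∫ x, R (coloringPow f Φ x) ∂μ ≤ 1 := by
      rw [integral_comp_coloringPow μ hf]
      calc ∑ w, μ.real (coloringPow f Φ ⁻¹' {w}) * R w
          ≤ ∑ w, (colorWeight q Φ t (E w) : ℝ) / N ^ Φ.card := by
            refine Finset.sum_le_sum fun w _ => ?_
            rcases eq_or_ne (μ.real (coloringPow f Φ ⁻¹' {w})) 0 with h | h
            · rw [h, zero_mul]; positivity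
            · refine le_of_eq ?_
              simp only [R]
              field_simp
        _ = ((∑ w, colorWeight q Φ t (E w) : ℕ) : ℝ) / N ^ Φ.card := by
            rw [← Finset.sum_div]; push_cast; rfl
        _ ≤ 1 := by
            rw [div_le_one hN']
            exact_mod_cast sum_colorWeight_le Φ t (sum_letterWeight_le μ hf t M) E hE
    rw [integral_div, integral_sub (integrable_comp_coloringPow μ hf Φ R) (integrable_const _)]
    refine div_nonpos_of_nonpos_of_nonneg ?_ hlog.le
    simpa using h1
  have hint : Integrable (fun x => condInfo μ f Φ t x + c) μ :=
    (integrable_condInfo μ hf Φ t).add (integrable_const c)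
  have key : ∫ x, (info μ f Φ x - (condInfo μ f Φ t x + c)) ∂μ ≤
      ∫ x, (R (coloringPow f Φ x) - 1) / Real.log 2 ∂μ := by
    refine integral_mono_ae ((integrable_info μ hf Φ).sub hint)
      (integrable_comp_coloringPow μ hf Φ fun w => (R w - 1) / Real.log 2) ?_
    filter_upwards [ae_forall_colorClass_pos (Γ := Γ) μ f] with x hx
    have hW := pow_card_le_mul_colorWeight μ hf Φ t hM hN hx
    rw [colorWeight_congr q t (w' := E (coloringPow f Φ x)) fun γ hγ =>
      (hE (coloringPow f Φ x) ⟨γ, hγ⟩).symm] at hW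
    change (N : ℝ) ^ Φ.card ≤ 2 ^ (condInfo μ f Φ t x + c) *
      (colorWeight q Φ t (E (coloringPow f Φ x)) : ℝ) at hW
    set W : ℝ := (colorWeight q Φ t (E (coloringPow f Φ x)) : ℝ)
    have h2 : (0 : ℝ) < 2 ^ (condInfo μ f Φ t x + c) := by positivity
    have hWpos : 0 < W := pos_of_mul_pos_right (hN'.trans_le hW) h2.le
    have hP := hx Φ
    have hRx : R (coloringPow f Φ x) = W / (N ^ Φ.card * μ.real (colorClass f Φ x)) := by
      simp only [R, ← colorClass_eq_preimage]
      rfl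
    have h3 : info μ f Φ x - (condInfo μ f Φ t x + c) ≤ Real.logb 2 (R (coloringPow f Φ x)) := by
      have h4 : Real.logb 2 (N ^ Φ.card) ≤ condInfo μ f Φ t x + c + Real.logb 2 W := by
        have := Real.logb_le_logb_of_le one_lt_two hN' hW
        rwa [Real.logb_mul h2.ne' hWpos.ne', Real.logb_rpow two_pos (by norm_num)] at this
      rw [hRx, Real.logb_div hWpos.ne' (by positivity), Real.logb_mul hN'.ne' hP.ne', info]
      linarith
    refine h3.trans ?_
    rw [Real.logb]
    gcongr
    exact Real.log_le_sub_one_of_pos (by rw [hRx]; positivity)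
  rw [integral_sub (integrable_info μ hf Φ) hint, integral_info μ hf,
    integral_add (integrable_condInfo μ hf Φ t) (integrable_const _)] at key
  have hc : ∫ _, c ∂μ = c := by simp
  linarith

theorem tendsto_logb_add_div (k : ℕ) :
    Tendsto (fun M : ℕ => Real.logb 2 ((M + k : ℕ) / M)) atTop (𝓝 0) := by
  have h1 : Tendsto (fun M : ℕ => 1 + (k : ℝ) / M) atTop (𝓝 (1 + 0)) :=
    tendsto_const_nhds.add (tendsto_const_div_atTop_nhds_zero_nat _)
  have h2 := (Real.continuousAt_logb (b := 2) (x := 1 + 0) (by norm_num)).tendsto.comp h1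
  rw [add_zero, Real.logb_one] at h2
  refine h2.congr' ?_
  filter_upwards [eventually_gt_atTop 0] with M hM
  have : (M : ℝ) ≠ 0 := by positivity
  simp only [Function.comp]
  congr 1
  push_cast
  field_simp

theorem shannonEntropy_le_integral_condInfo [Countable Γ] [Inhabited V]
    [IsProbabilityMeasure μ] [SMulInvariantMeasure Γ X μ] (hf : Measurable f) (Φ : Finset Γ)
    (t : Fin r → Γ) : shannonEntropy μ (coloringPow f Φ) ≤ ∫ x, condInfo μ f Φ t x ∂μ := by
  have h := ((tendsto_logb_add_div (Fintype.card V)).const_mul (Φ.card : ℝ)).const_add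
    (∫ x, condInfo μ f Φ t x ∂μ)
  rw [mul_zero, add_zero] at h
  refine ge_of_tendsto h ?_
  filter_upwards [eventually_gt_atTop 0] with M hM
  exact shannonEntropy_le_integral_condInfo_add μ hf Φ t hM

/-- A Shearer-type inequality: each term of the sum over `g ∈ F` is at least the entropy on `Φ`. -/
theorem card_mul_shannonEntropy_le [Countable Γ] [Inhabited V]
    [IsProbabilityMeasure μ] [SMulInvariantMeasure Γ X μ] (hf : Measurable f) (Φ F : Finset Γ) :
    F.card * shannonEntropy μ (coloringPow f Φ) ≤
      (F⁻¹ * Φ).card * shannonEntropy μ (coloringPow f F) := by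
  refine le_trans ?_ (sum_integral_condInfo_le μ hf Φ F)
  rw [← nsmul_eq_mul]
  exact Finset.card_nsmul_le_sum _ _ _ fun g _ => shannonEntropy_le_integral_condInfo μ hf Φ _

theorem shannonEntropy_coloringPow_nonneg [IsProbabilityMeasure μ] (f : X → V)
    (Φ : Finset Γ) : 0 ≤ shannonEntropy μ (coloringPow f Φ) := by
  rw [shannonEntropy, neg_nonneg]
  exact Finset.sum_nonpos fun w _ => mul_nonpos_of_nonneg_of_nonpos measureReal_nonneg
    (Real.logb_nonpos one_lt_two measureReal_nonneg measureReal_le_one)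

end LetterWeight

/-! ### Existence of the Kolmogorov–Sinai entropy -/

section Folner

variable {Γ : Type*} [Group Γ] [DecidableEq Γ]

theorem card_inv_mul_le (F Φ : Finset Γ) :
    (F⁻¹ * Φ).card ≤ Φ.card + ∑ g ∈ F, ((g⁻¹ • Φ) ∆ Φ).card := by
  have : F⁻¹ * Φ ⊆ Φ ∪ F.biUnion fun g => (g⁻¹ • Φ) ∆ Φ := by
    intro γ hγ
    obtain ⟨a, ha, b, hb, rfl⟩ := Finset.mem_mul.1 hγ
    by_cases h : a * b ∈ Φ
    · exact Finset.mem_union_left _ h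
    · refine Finset.mem_union_right _ (Finset.mem_biUnion.2 ⟨a⁻¹, by simpa using ha, ?_⟩)
      rw [inv_inv, Finset.mem_symmDiff]
      exact Or.inl ⟨Finset.smul_mem_smul_finset hb, h⟩
  exact (Finset.card_le_card this).trans ((Finset.card_union_le _ _).trans
    (Nat.add_le_add_left Finset.card_biUnion_le _))

theorem IsFolnerSeq.exists_card_inv_mul_le {Ψ : ℕ → Finset Γ} (hΨ : IsFolnerSeq Ψ)
    (F : Finset Γ) : ∃ ρ : ℕ → ℝ, Tendsto ρ atTop (𝓝 1) ∧
      ∀ n, ((F⁻¹ * Ψ n).card : ℝ) ≤ ρ n * (Ψ n).card := by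
  refine ⟨fun n => 1 + ∑ g ∈ F, (((g⁻¹ • Ψ n) ∆ Ψ n).card : ℝ) / (Ψ n).card, ?_, fun n => ?_⟩
  · have := (tendsto_finsetSum F fun g _ => hΨ.tendsto g⁻¹).const_add 1
    simpa using this
  · have hpos : (0 : ℝ) < (Ψ n).card := by exact_mod_cast (hΨ.nonempty n).card_pos
    beta_reduce
    rw [← Finset.sum_div, add_mul, one_mul, div_mul_cancel₀ _ hpos.ne']
    exact_mod_cast card_inv_mul_le F (Ψ n)

end Folner

section Entropy

variable {Γ X V : Type*} [Group Γ] [LinearOrder Γ] [MulAction Γ X] [MeasurableSpace X]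
  (μ : Measure X) [Fintype V]

/-- The infimum of the normalized entropies over the nonempty finite sets. -/
noncomputable def infEntropy (Γ : Type*) {X V : Type*} [Group Γ] [LinearOrder Γ] [MulAction Γ X]
    [MeasurableSpace X] (μ : Measure X) [Fintype V] (f : X → V) : ℝ :=
  ⨅ F : {F : Finset Γ // F.Nonempty}, shannonEntropy μ (coloringPow f F.1) / F.1.card

theorem exists_lt_infEntropy_add (f : X → V) {ε : ℝ} (hε : 0 < ε) :
    ∃ F : Finset Γ, F.Nonempty ∧
      shannonEntropy μ (coloringPow f F) / F.card < infEntropy Γ μ f + ε := by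
  have : Nonempty {F : Finset Γ // F.Nonempty} := ⟨⟨{1}, Finset.singleton_nonempty 1⟩⟩
  obtain ⟨F, hF⟩ := exists_lt_of_ciInf_lt (lt_add_of_pos_right (infEntropy Γ μ f) hε)
  exact ⟨F.1, F.2, hF⟩

variable [MeasurableSpace V] [MeasurableSingletonClass V] [MeasurableConstSMul Γ X]

theorem infEntropy_le [IsProbabilityMeasure μ] (f : X → V) {F : Finset Γ} (hF : F.Nonempty) :
    infEntropy Γ μ f ≤ shannonEntropy μ (coloringPow f F) / F.card :=
  ciInf_le ⟨0, by
    rintro _ ⟨G, rfl⟩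
    exact div_nonneg (shannonEntropy_coloringPow_nonneg μ f _) (Nat.cast_nonneg _)⟩
    (⟨F, hF⟩ : {F : Finset Γ // F.Nonempty})

theorem isKSEntropy_infEntropy [Countable Γ] [Inhabited V] [IsProbabilityMeasure μ]
    [SMulInvariantMeasure Γ X μ] {f : X → V} (hf : Measurable f) :
    IsKSEntropy Γ μ f (infEntropy Γ μ f) := by
  intro Ψ hΨ
  refine tendsto_order.2 ⟨fun a ha => .of_forall fun n =>
    ha.trans_le (infEntropy_le μ f (hΨ.nonempty n)), fun a ha => ?_⟩
  obtain ⟨F, hF, hlt⟩ := exists_lt_infEntropy_add (Γ := Γ) μ f (sub_pos.2 ha)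
  rw [add_sub_cancel] at hlt
  obtain ⟨ρ, hρ, hle⟩ := hΨ.exists_card_inv_mul_le F
  have hlim := hρ.mul_const (shannonEntropy μ (coloringPow f F) / F.card)
  rw [one_mul] at hlim
  filter_upwards [hlim.eventually_lt_const hlt] with n hn
  refine lt_of_le_of_lt ?_ hn
  have hFpos : (0 : ℝ) < F.card := by exact_mod_cast hF.card_pos
  have hpos : (0 : ℝ) < (Ψ n).card := by exact_mod_cast (hΨ.nonempty n).card_pos
  rw [mul_div_assoc', div_le_div_iff₀ hpos hFpos]
  have h1 := card_mul_shannonEntropy_le μ hf (Ψ n) F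
  have h2 := mul_le_mul_of_nonneg_right (hle n) (shannonEntropy_coloringPow_nonneg μ f F)
  linarith

end Entropy

/-! ### Mean Kolmogorov complexity -/

/-- The extra `1` pays for rounding `U` up to a whole number of bits. -/
theorem lintegral_toENNReal_div_le {X : Type*} [MeasurableSpace X] (μ : Measure X)
    [IsProbabilityMeasure μ] {K : X → ℕ∞} {U : X → ℝ} (hU : Integrable U μ) (hU0 : 0 ≤ᵐ[μ] U)
    (b : ℕ) (hK : ∀ᵐ x ∂μ, K x ≤ (⌈U x⌉₊ + b : ℕ)) {n : ℕ} (hn : 0 < n) :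
    ∫⁻ x, (K x : ℝ≥0∞) / (n : ℝ≥0∞) ∂μ ≤ ENNReal.ofReal ((∫ x, U x ∂μ + (1 + b)) / n) := by
  have hn' : (0 : ℝ) < n := by exact_mod_cast hn
  have hint : Integrable (fun x => (U x + (1 + b)) / n) μ :=
    (hU.add (integrable_const _)).div_const _
  have hval : ∫ x, (U x + (1 + b)) / n ∂μ = (∫ x, U x ∂μ + (1 + b)) / n := by
    rw [integral_div, integral_add hU (integrable_const _)]
    simp
  rw [← hval, ofReal_integral_eq_lintegral_ofReal hint]
  · refine lintegral_mono_ae ?_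
    filter_upwards [hK, hU0] with x hx hx0
    rw [ENNReal.ofReal_div_of_pos hn', ENNReal.ofReal_natCast]
    gcongr
    calc (K x : ℝ≥0∞) ≤ ((⌈U x⌉₊ + b : ℕ) : ℝ≥0∞) := by
          simpa using ENat.toENNReal_mono hx
      _ = ENNReal.ofReal ((⌈U x⌉₊ + b : ℕ) : ℝ) := (ENNReal.ofReal_natCast _).symm
      _ ≤ ENNReal.ofReal (U x + (1 + b)) := by
          refine ENNReal.ofReal_le_ofReal ?_
          have := Nat.ceil_lt_add_one hx0
          push_cast
          linarith
  · filter_upwards [hU0] with x hx0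
    have : 0 ≤ U x := hx0
    exact div_nonneg (by positivity) hn'.le

theorem Nat.size_le_logb_add_one {m : ℕ} (hm : 0 < m) : (Nat.size m : ℝ) ≤ Real.logb 2 m + 1 := by
  have h1 : 0 < Nat.size m := Nat.size_pos.2 hm
  have h2 : 2 ^ (Nat.size m - 1) ≤ m := Nat.lt_size.1 (by omega)
  have h3 : ((Nat.size m - 1 : ℕ) : ℝ) ≤ Real.logb 2 m := by
    rw [Real.le_logb_iff_rpow_le one_lt_two (by exact_mod_cast hm), Real.rpow_natCast]
    exact_mod_cast h2
  rw [Nat.cast_sub h1] at h3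
  push_cast at h3
  linarith

/-! ### Negligibility of the header cost -/

section Growth

variable {Γ : Type*} [Group Γ] [DecidableEq Γ] {S : Set Γ} {Φ : ℕ → Finset Γ}

theorem IsGoodFolnerSeq.tendsto_card (hΦ : IsGoodFolnerSeq S Φ) :
    Tendsto (fun n => ((Φ n).card : ℝ)) atTop atTop := by
  refine tendsto_atTop_mono' _ ?_ hΦ.growth
  filter_upwards [eventually_ge_atTop 2] with n hn
  refine div_le_self (Nat.cast_nonneg _) ?_
  rw [Real.le_logb_iff_rpow_le one_lt_two (by positivity), Real.rpow_one]
  exact_mod_cast hn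

theorem IsGoodFolnerSeq.tendsto_size_div_card (hΦ : IsGoodFolnerSeq S Φ) (c : ℕ) :
    Tendsto (fun n => (1 + ((2 * Nat.size n + c : ℕ) : ℝ)) / (Φ n).card) atTop (𝓝 0) := by
  have h1 : Tendsto (fun n : ℕ => Real.logb 2 n / (Φ n).card) atTop (𝓝 0) := by
    simpa only [inv_div, Function.comp_def] using
      tendsto_inv_atTop_zero.comp hΦ.growth
  have h2 : Tendsto (fun n : ℕ => (3 + c : ℝ) / (Φ n).card) atTop (𝓝 0) :=
    hΦ.tendsto_card.const_div_atTop _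
  have h3 := h2.add (h1.const_mul 2)
  rw [mul_zero, add_zero] at h3
  refine squeeze_zero' (.of_forall fun n => by positivity) ?_ h3
  filter_upwards [eventually_gt_atTop 0] with n hn
  rw [mul_div_assoc', ← add_div]
  refine div_le_div_of_nonneg_right ?_ (Nat.cast_nonneg _)
  have := Nat.size_le_logb_add_one hn
  push_cast
  linarith

end Growth

section Complexity

variable {Γ X : Type*} [Group Γ] [LinearOrder Γ] [MulAction Γ X] [MeasurableSpace X]
  (μ : Measure X) [IsProbabilityMeasure μ] [MeasurableConstSMul Γ X] [SMulInvariantMeasure Γ X μ]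
  {S : Set Γ} {Φ : ℕ → Finset Γ} {O : ℕ → ℕ} {e : Γ ≃ ℕ} {D : List Bool →. List Bool}
  {s : ℕ} {f : X → (Fin s → Bool)}

theorem exists_lintegral_complexityOf_le (hO : IsSuitableOracle O e Φ) (hD : IsOptimal O D)
    (hΦ : ∀ m, (Φ m).Nonempty) (hf : Measurable f) {M N : ℕ} (hM : 0 < M)
    (hN : N = M + Fintype.card (Fin s → Bool)) {r : ℕ} (t : Fin r → Γ) :
    ∃ c : ℕ, ∀ m, ∫⁻ x, (complexityOf D (wordOf (coloringPow f (Φ m) x)) : ℝ≥0∞) /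
        ((Φ m).card : ℝ≥0∞) ∂μ ≤
      ENNReal.ofReal ((∫ x, condInfo μ f (Φ m) t x ∂μ + (Φ m).card * Real.logb 2 (N / M) +
        (1 + (2 * Nat.size m + c : ℕ))) / (Φ m).card) := by
  have : Countable Γ := e.injective.countable
  have hN0 : 0 < N := by omega
  have hM' : (0 : ℝ) < M := by exact_mod_cast hM
  obtain ⟨c, hc⟩ := hD.complexityOf_wordOf_le hO t hN0
    (fun u => (sum_letterWeight_le μ hf t M u).trans hN.ge)
  refine ⟨c, fun m => ?_⟩
  have hlog : 0 ≤ Real.logb 2 ((N : ℝ) / M) := by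
    refine Real.logb_nonneg one_lt_two ?_
    rw [one_le_div hM']
    exact_mod_cast (by omega : M ≤ N)
  have hint := integrable_condInfo μ hf (Φ m) t
  have hintU : Integrable
      (fun x => condInfo μ f (Φ m) t x + (Φ m).card * Real.logb 2 ((N : ℝ) / M)) μ :=
    hint.add (integrable_const _)
  have hval : ∫ x, (condInfo μ f (Φ m) t x + (Φ m).card * Real.logb 2 ((N : ℝ) / M)) ∂μ =
      ∫ x, condInfo μ f (Φ m) t x ∂μ + (Φ m).card * Real.logb 2 ((N : ℝ) / M) := by
    rw [integral_add hint (integrable_const _)]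
    simp
  rw [← hval]
  have hpos := ae_forall_colorClass_pos (Γ := Γ) μ f
  refine lintegral_toENNReal_div_le μ hintU ?_ _ ?_ (hΦ m).card_pos
  · filter_upwards [hpos] with x hx
    exact add_nonneg (condInfo_nonneg μ (Φ m) t hx) (mul_nonneg (Nat.cast_nonneg _) hlog)
  · filter_upwards [hpos] with x hx
    set U := condInfo μ f (Φ m) t x + (Φ m).card * Real.logb 2 ((N : ℝ) / M)
    rw [← add_assoc]
    refine hc m ⌈U⌉₊ (fun γ => f (γ • x)) ?_
    have h1 := pow_card_le_mul_colorWeight μ hf (Φ m) t hM hN0 hx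
    have h2 : (2 : ℝ) ^ U ≤ (2 : ℝ) ^ ⌈U⌉₊ := by
      rw [← Real.rpow_natCast]
      exact Real.rpow_le_rpow_of_exponent_le one_le_two (Nat.le_ceil _)
    have h3 := h1.trans (mul_le_mul_of_nonneg_right h2 (Nat.cast_nonneg _))
    exact_mod_cast h3

theorem limsup_lintegral_complexityOf_le_add (hO : IsSuitableOracle O e Φ) (hD : IsOptimal O D)
    (hΦ : IsGoodFolnerSeq S Φ) (hf : Measurable f) {M : ℕ} (hM : 0 < M) {F : Finset Γ}
    (hF : F.Nonempty) :
    limsup (fun m : ℕ => ∫⁻ x, (complexityOf D (wordOf (coloringPow f (Φ m) x)) : ℝ≥0∞) /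
        ((Φ m).card : ℝ≥0∞) ∂μ) atTop ≤
      ENNReal.ofReal (shannonEntropy μ (coloringPow f F) / F.card +
        Real.logb 2 ((M + Fintype.card (Fin s → Bool) : ℕ) / M)) := by
  -- The good `g` varies with `m`, and the decoder's constant with `g`; since `g` stays in the
  -- finite set `F`, the constant `F.sup c` serves all `m`.
  have : Countable Γ := e.injective.countable
  choose c hc using fun g : Γ => exists_lintegral_complexityOf_le μ hO hD
    hΦ.nonempty hf hM rfl (translates F g)
  obtain ⟨ρ, hρ, hle⟩ := hΦ.toIsFolnerSeq.exists_card_inv_mul_le F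
  set L := Real.logb 2 ((M + Fintype.card (Fin s → Bool) : ℕ) / (M : ℝ))
  set h := shannonEntropy μ (coloringPow f F)
  have hh0 : 0 ≤ h := shannonEntropy_coloringPow_nonneg μ f F
  have hFpos : (0 : ℝ) < F.card := by exact_mod_cast hF.card_pos
  have hlim := ((hρ.mul_const (h / F.card)).add_const L).add
    (hΦ.tendsto_size_div_card (F.sup c))
  rw [one_mul, add_zero] at hlim
  rw [← (ENNReal.tendsto_ofReal hlim).limsup_eq]
  refine limsup_le_limsup (.of_forall fun m => ?_)
  have hpos : (0 : ℝ) < (Φ m).card := by exact_mod_cast (hΦ.nonempty m).card_pos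
  obtain ⟨g, hg, hgle⟩ : ∃ g ∈ F, ∫ x, condInfo μ f (Φ m) (translates F g) x ∂μ ≤
      ρ m * (Φ m).card * h / F.card := by
    refine Finset.exists_le_of_sum_le hF ((sum_integral_condInfo_le μ hf (Φ m) F).trans ?_)
    rw [Finset.sum_const, nsmul_eq_mul, mul_div_cancel₀ _ hFpos.ne']
    exact mul_le_mul_of_nonneg_right (hle m) hh0
  refine (hc g m).trans (ENNReal.ofReal_le_ofReal ?_)
  rw [div_le_iff₀ hpos]
  have hcg : ((2 * Nat.size m + c g : ℕ) : ℝ) ≤ (2 * Nat.size m + F.sup c : ℕ) := by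
    exact_mod_cast Nat.add_le_add_left (Finset.le_sup hg) _
  have hrhs : (ρ m * (h / F.card) + L + (1 + ((2 * Nat.size m + F.sup c : ℕ) : ℝ)) /
      (Φ m).card) * (Φ m).card = ρ m * (Φ m).card * h / F.card + (Φ m).card * L +
        (1 + ((2 * Nat.size m + F.sup c : ℕ) : ℝ)) := by
    field_simp
  rw [hrhs]
  linarith

theorem limsup_lintegral_complexityOf_le_infEntropy (hO : IsSuitableOracle O e Φ)
    (hD : IsOptimal O D) (hΦ : IsGoodFolnerSeq S Φ) (hf : Measurable f) :
    limsup (fun m : ℕ => ∫⁻ x, (complexityOf D (wordOf (coloringPow f (Φ m) x)) : ℝ≥0∞) /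
        ((Φ m).card : ℝ≥0∞) ∂μ) atTop ≤ ENNReal.ofReal (infEntropy Γ μ f) := by
  have hF : ∀ F : Finset Γ, F.Nonempty →
      limsup (fun m : ℕ => ∫⁻ x, (complexityOf D (wordOf (coloringPow f (Φ m) x)) : ℝ≥0∞) /
        ((Φ m).card : ℝ≥0∞) ∂μ) atTop ≤
      ENNReal.ofReal (shannonEntropy μ (coloringPow f F) / F.card) := by
    intro F hF
    have hlim := (tendsto_logb_add_div (Fintype.card (Fin s → Bool))).const_add
      (shannonEntropy μ (coloringPow f F) / F.card)
    rw [add_zero] at hlim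
    refine ge_of_tendsto (ENNReal.tendsto_ofReal hlim) ?_
    filter_upwards [eventually_gt_atTop 0] with M hM
    exact limsup_lintegral_complexityOf_le_add μ hO hD hΦ hf hM hF
  have hlim := (tendsto_one_div_add_atTop_nhds_zero_nat (𝕜 := ℝ)).const_add (infEntropy Γ μ f)
  rw [add_zero] at hlim
  refine ge_of_tendsto' (ENNReal.tendsto_ofReal hlim) fun n => ?_
  obtain ⟨F, hFne, hlt⟩ := exists_lt_infEntropy_add (Γ := Γ) μ f
    (Nat.one_div_pos_of_nat (α := ℝ) (n := n))
  exact (hF F hFne).trans (ENNReal.ofReal_le_ofReal hlt.le)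

end Complexity

theorem mainTheorem11
    {Γ : Type*} [Group Γ] [LinearOrder Γ]
    {X : Type*} [MeasurableSpace X] [StandardBorelSpace X]
    (μ : Measure X) [IsProbabilityMeasure μ]
    [MulAction Γ X] [MeasurableConstSMul Γ X] [ErgodicSMul Γ X μ]
    (hfree : ∀ᵐ x ∂μ, ∀ γ : Γ, γ • x = x → γ = 1)
    (S : Set Γ) (hS : Subgroup.closure S = ⊤)
    (Φ : ℕ → Finset Γ) (hΦ : IsGoodFolnerSeq S Φ)
    (O : ℕ → ℕ) (e : Γ ≃ ℕ) (hO : IsSuitableOracle O e Φ)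
    (D : List Bool →. List Bool) (hD : IsOptimal O D)
    (s : ℕ) (f : X → (Fin s → Bool)) (hf : Measurable f) :
    ∃ H : ℝ, IsKSEntropy Γ μ f H ∧
      limsup (fun m : ℕ =>
        ∫⁻ x, (complexityOf D (wordOf (coloringPow f (Φ m) x)) : ℝ≥0∞) / ((Φ m).card : ℝ≥0∞) ∂μ)
        atTop ≤ ENNReal.ofReal H := by
  have : Countable Γ := e.injective.countable
  -- An infimum of nonnegative quotients is nonnegative, so `ENNReal.ofReal` truncates nothing.
  exact ⟨infEntropy Γ μ f, isKSEntropy_infEntropy μ hf,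
    limsup_lintegral_complexityOf_le_infEntropy μ hO hD hΦ hf⟩
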